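/- **Theorem (Identification of the metastable state).** Let $q>2$ and $K,L\ge 1$ be integers and let $\Lambda=(V,E)$ be the $K\times L$ grid graph with periodic boundary conditions (the discrete torus), $V=\{0,\dots,K-1\}\times\{0,\dots,L-1\}$. Let $\mathcal X=\{1,\dots,q\}^V$ and, for $0<h<1$, let $$H(\sigma)=-\sum_{\{v,w\}\in E}\mathbf 1_{\{\sigma(v)=\sigma(w)\}}+h\sum_{u\in V}\mathbf 1_{\{\sigma(u)=1\}},\qquad \sigma\in\mathcal X,$$ be the Hamiltonian of the $q$-state Potts model with negative external field $-h$. A path from $\sigma$ to $\sigma'$ is a finite sequence $\omega=(\omega_0,\dots,\omega_n)$ in $\mathcal X$, $n\ge 0$, with $\omega_0=\sigma$, $\omega_n=\sigma'$, in which consecutive configurations differ at exactly one vertex. Put $$\Phi(\sigma,\sigma')=\min_{\omega:\sigma\to\sigma'}\ \max_{i} H(\omega_i),\qquad \Phi(\sigma,\mathcal A)=\min_{\sigma'\in\mathcal A}\Phi(\sigma,\sigma'),\qquad \Gamma(\sigma,\mathcal A)=\Phi(\sigma,\mathcal A)-H(\sigma)$$ for non-empty $\mathcal A\subseteq\mathcal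 X$. The stability level of $\sigma$ is $V_\sigma=\Gamma(\sigma,\mathcal I_\sigma)$ with $\mathcal I_\sigma=\{\eta\in\mathcal X: H(\eta)<H(\sigma)\}$, and $V_\sigma=\infty$ if $\mathcal I_\sigma=\varnothing$. Let $\mathcal X^s$ be the set of global minimizers of $H$ (the stable states) and let $$\mathcal X^m=\Big\{\eta\in\mathcal X:\ V_\eta=\max_{\sigma\in\mathcal X\setminus\mathcal X^s}V_\sigma\Big\}$$ be the set of metastable states. Let $\ell^*=\lceil 2/h\rceil$, and assume that $2/h$ is not an integer and that $L\ge K\ge 3\ell^*$. Then the only metastable state is the configuration $\mathbf 1$ with all spins equal to $1$, $$\mathcal X^m=\{\mathbf 1\},$$ and its stability level is $$V_{\mathbf 1}=\Gamma(\mathbf 1,\mathcal X^s)=4\ell^*-h\big(\ell^*(\ell^*-1)+1\big).$$ -/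

import Mathlib

noncomputable section

/-! ### Energy landscapes `(X, H, Q)` -/

namespace Landscape

/-- A path `ω₀, …, ωₙ` from `σ` to `σ'`: consecutive states are connected by `Q`. -/
structure Path {X : Type*} (Q : X → X → ℝ) (σ σ' : X) where
  length : ℕ
  state : Fin (length + 1) → X
  source : state 0 = σ
  target : state (Fin.last length) = σ'
  step : ∀ i : Fin length, 0 < Q (state i.castSucc) (state i.succ)

/-- The height `max_i H(ωᵢ)` of a path. -/
def Path.height {X : Type*} {Q : X → X → ℝ} {σ σ' : X} (H : X → ℝ) (ω : Path Q σ σ') : ℝ :=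
  Finset.univ.sup' ⟨0, Finset.mem_univ 0⟩ (fun i => H (ω.state i))

/-- The communication height `Φ(σ, σ')`, the minimal height of a path from `σ` to `σ'`.
On a finite `X` the heights take finitely many values, so the infimum is a minimum; it is `⊤`
when there is no path. -/
def commHeight {X : Type*} (H : X → ℝ) (Q : X → X → ℝ) (σ σ' : X) : EReal :=
  ⨅ ω : Path Q σ σ', (ω.height H : EReal)

/-- The communication height `Φ(A, B) = min_{σ ∈ A, σ' ∈ B} Φ(σ, σ')` between two sets. -/
def commHeightSet {X : Type*} (H : X → ℝ) (Q : X → X → ℝ) (A B : Set X) : EReal :=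
  ⨅ σ ∈ A, ⨅ σ' ∈ B, commHeight H Q σ σ'

/-- The energy barrier `Γ(σ, A) = Φ(σ, A) - H(σ)`. -/
def barrier {X : Type*} (H : X → ℝ) (Q : X → X → ℝ) (σ : X) (A : Set X) : EReal :=
  commHeightSet H Q {σ} A - (H σ : EReal)

/-- The states of energy strictly below that of `σ`. -/
def lowerStates {X : Type*} (H : X → ℝ) (σ : X) : Set X := {η | H η < H σ}

/-- The stability level `V_σ = Φ(σ, I_σ) - H(σ)`, where `I_σ` is the set of states of energy
strictly below `H(σ)`; it is `⊤` when `I_σ` is empty (an infimum over the empty set). -/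
def stabilityLevel {X : Type*} (H : X → ℝ) (Q : X → X → ℝ) (σ : X) : EReal :=
  barrier H Q σ (lowerStates H σ)

/-- The bottom of a set: the minimizers of `H` on it. -/
def bottom {X : Type*} (H : X → ℝ) (A : Set X) : Set X := {η | η ∈ A ∧ ∀ σ ∈ A, H η ≤ H σ}

/-- The stable states: the global minimizers of `H`. -/
def stableStates {X : Type*} (H : X → ℝ) : Set X := bottom H Set.univ

/-- The metastable states: those whose stability level is the maximal stability level of the
states that are not stable (the supremum is a maximum on a finite `X`). -/
def metastableStates {X : Type*} (H : X → ℝ) (Q : X → X → ℝ) : Set X :=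
  {η | stabilityLevel H Q η = ⨆ σ ∈ (stableStates H)ᶜ, stabilityLevel H Q σ}

end Landscape

/-! ### The Potts model on the torus -/

namespace Potts

/-- The set of spin values `{1, …, q}`. -/
abbrev Spin (q : ℕ) : Type := {s : ℕ // s ∈ Finset.Icc 1 q}

/-- The `K × L` grid with periodic boundary conditions. -/
def torus (K L : ℕ) : SimpleGraph (Fin K × Fin L) :=
  SimpleGraph.boxProd (SimpleGraph.cycleGraph K) (SimpleGraph.cycleGraph L)

/-- Spin configurations. -/
abbrev Config (K L q : ℕ) : Type := Fin K × Fin L → Spin q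

open Classical in
/-- The Hamiltonian with negative field `-h`: minus the number of edges whose two endpoints carry
the same spin, plus `h` times the number of vertices with spin `1`. -/
def energy (K L q : ℕ) (h : ℝ) (σ : Config K L q) : ℝ :=
  -(∑ e ∈ (torus K L).edgeFinset, if (e.map σ).IsDiag then (1 : ℝ) else 0)
    + h * ∑ u : Fin K × Fin L, if (σ u : ℕ) = 1 then (1 : ℝ) else 0

/-- The connectivity matrix of single-spin updates. -/
def connectivity (K L q : ℕ) (σ σ' : Config K L q) : ℝ :=
  if (Finset.univ.filter fun v => σ v ≠ σ' v).card = 1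
    then 1 / ((q : ℝ) * (Fintype.card (Fin K × Fin L) : ℝ)) else 0

/-- The configuration with all spins equal to `1`. -/
def allOne (K L q : ℕ) (hq : 2 < q) : Config K L q :=
  fun _ => ⟨1, Finset.mem_Icc.mpr ⟨le_refl 1, by omega⟩⟩

/-- The critical length `ℓ* = ⌈2/h⌉`. -/
def criticalLength (h : ℝ) : ℕ := ⌈2 / h⌉₊

end Potts

end

/-! The proof separates a barrier of at most 2, valid for every non-stable configuration with a spin
different from `1`, from the nucleation barrier Γ of the all-`1` configuration, which exceeds 2.

For the first bound (`exists_reach_energy_lt`), suppose that no lower energy is reachable within 2.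
Fix a spin `s ≠ 1` that is present and, among the reachable states of equal energy, maximize the
number of `s`. The result is `Extremal`: concave corners of the phase `s` fill at no cost, so a
maximal rectangle of `s` either contains a full line, which spreads over the torus, or has no `s`
along any of its sides. The latter is impossible. On each side, expanding the rectangle by a line
must raise the energy, while letting the outside spins consume its outermost line must not lower it;
and an unchanging side must carry spin `1`, since any other spin would consume the whole rectangle.
Around the corners these inequalities contradict each other (`not_all_sides`). Hence the
configuration is constant of spin `s` (`Extremal.eq_const`) and so a ground state.

For the all-`1` configuration, any lower state has more than ℓ(ℓ-1) spins different from `1`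
(`energy_allOne_le`), so a path to it passes through the area ℓ(ℓ-1)+1. There an isoperimetric
inequality, obtained by counting rows and columns that are neither free of such spins nor full of
them, gives excess energy Γ (`energy_critical_le`). Conversely, growing a droplet through squares
and quasi-squares never exceeds Γ (`reach_droplet_square`); once it is below the all-`1` energy,
repeated descent with barrier 2 leads to a ground state (`exists_reach_stable`). -/

namespace Potts

/-! ### The energy as a sum over the vertices of the torus -/

/-- The indicator that two spins agree. -/
noncomputable def agr {q : ℕ} (a b : Spin q) : ℝ := if a = b then 1 else 0

/-- The indicator that two spins disagree. -/
noncomputable def dis {q : ℕ} (a b : Spin q) : ℝ := if a = b then 0 else 1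

/-- The indicator of the spin `1`. -/
noncomputable def one {q : ℕ} (a : Spin q) : ℝ := if (a : ℕ) = 1 then 1 else 0

section Indicators

variable {q : ℕ} (a b : Spin q)

theorem agr_eq : agr a b = 1 - dis a b := by
  unfold agr dis; split_ifs <;> norm_num

theorem dis_nonneg : 0 ≤ dis a b := by
  unfold dis; split_ifs <;> norm_num

theorem dis_le_one : dis a b ≤ 1 := by
  unfold dis; split_ifs <;> norm_num

theorem dis_comm : dis a b = dis b a := by
  unfold dis; simp only [eq_comm]

theorem agr_comm : agr a b = agr b a := by
  rw [agr_eq, agr_eq, dis_comm]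

@[simp] theorem dis_self : dis a a = 0 := by simp [dis]

@[simp] theorem agr_self : agr a a = 1 := by simp [agr]

theorem agr_nonneg : 0 ≤ agr a b := by
  unfold agr; split_ifs <;> norm_num

theorem agr_le_one : agr a b ≤ 1 := by
  unfold agr; split_ifs <;> norm_num

theorem one_nonneg : 0 ≤ one a := by
  unfold one; split_ifs <;> norm_num

variable {a b}

theorem agr_of_ne (h : a ≠ b) : agr a b = 0 := by simp [agr, h]

theorem dis_of_ne (h : a ≠ b) : dis a b = 1 := by simp [dis, h]

theorem one_of_ne (h : (a : ℕ) ≠ 1) : one a = 0 := by simp [one, h]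

theorem one_of_eq (h : (a : ℕ) = 1) : one a = 1 := by simp [one, h]

end Indicators

/-- The horizontal unit vector. -/
abbrev unitX (K L : ℕ) [NeZero K] [NeZero L] : Fin K × Fin L := (1, 0)

/-- The vertical unit vector. -/
abbrev unitY (K L : ℕ) [NeZero K] [NeZero L] : Fin K × Fin L := (0, 1)

theorem nsmul_one_val {K : ℕ} [NeZero K] (i : ℕ) : (i • (1 : Fin K)).val = i % K := by
  induction i with
  | zero => simp
  | succ i ih => rw [succ_nsmul, Fin.val_add, ih, Fin.val_one', ← Nat.add_mod]

theorem nsmul_one_ne_zero {K : ℕ} [NeZero K] {i : ℕ} (h0 : 0 < i) (hi : i < K) :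
    i • (1 : Fin K) ≠ 0 := by
  intro h
  have := congrArg Fin.val h
  rw [nsmul_one_val, Nat.mod_eq_of_lt hi] at this
  simp at this
  omega

theorem cycleGraph_adj_iff {K : ℕ} [NeZero K] (hK : 2 ≤ K) (u v : Fin K) :
    (SimpleGraph.cycleGraph K).Adj u v ↔ v = u + 1 ∨ u = v + 1 := by
  have h1 : (1 : Fin K) ≠ 0 := by simpa using nsmul_one_ne_zero (K := K) one_pos (by omega)
  obtain ⟨k, rfl⟩ : ∃ k, K = k + 1 := ⟨K - 1, by omega⟩
  rw [SimpleGraph.cycleGraph_eq_circulantGraph]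
  simp only [SimpleGraph.circulantGraph, SimpleGraph.fromRel_adj, Set.mem_singleton_iff,
    sub_eq_iff_eq_add']
  constructor
  · rintro ⟨-, h | h⟩
    · right; rw [h]
    · left; rw [h]
  · rintro (h | h)
    · refine ⟨fun h' => h1 ?_, Or.inr h⟩
      rw [h'] at h; simpa using h
    · refine ⟨fun h' => h1 ?_, Or.inl h⟩
      rw [h'] at h; simpa using h

theorem torus_adj_iff {K L : ℕ} [NeZero K] [NeZero L] (hK : 2 ≤ K) (hL : 2 ≤ L)
    (u v : Fin K × Fin L) :
    (torus K L).Adj u v ↔ v = u + unitX K L ∨ u = v + unitX K L ∨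
      v = u + unitY K L ∨ u = v + unitY K L := by
  rw [torus, SimpleGraph.boxProd_adj, cycleGraph_adj_iff hK, cycleGraph_adj_iff hL]
  simp only [Prod.ext_iff, Prod.fst_add, Prod.snd_add, add_zero]
  grind

/-- Orienting every edge in a positive direction counts it once: in length at least 3, `1 + 1 ≠ 0`,
so the steps `+1` and `-1` are different. -/
theorem sum_torus_edges {K L : ℕ} [NeZero K] [NeZero L] (hK : 3 ≤ K) (hL : 3 ≤ L)
    [Fintype (torus K L).edgeSet] (g : Sym2 (Fin K × Fin L) → ℝ) :
    ∑ e ∈ (torus K L).edgeFinset, g e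
      = ∑ v, (g s(v, v + unitX K L) + g s(v, v + unitY K L)) := by
  have x1 : (1 : Fin K) ≠ 0 := by simpa using nsmul_one_ne_zero (K := K) one_pos (by omega)
  have y1 : (1 : Fin L) ≠ 0 := by simpa using nsmul_one_ne_zero (K := L) one_pos (by omega)
  have x2 : (1 : Fin K) + 1 ≠ 0 := by
    simpa [two_nsmul] using nsmul_one_ne_zero (K := K) two_pos (by omega)
  have y2 : (1 : Fin L) + 1 ≠ 0 := by
    simpa [two_nsmul] using nsmul_one_ne_zero (K := L) two_pos (by omega)
  have hsum : ∑ v, (g s(v, v + unitX K L) + g s(v, v + unitY K L))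
      = ∑ w : (Fin K × Fin L) ⊕ (Fin K × Fin L),
        Sum.elim (fun v => g s(v, v + unitX K L)) (fun v => g s(v, v + unitY K L)) w := by
    rw [Fintype.sum_sum_type, Finset.sum_add_distrib]
    rfl
  rw [hsum]
  symm
  refine Finset.sum_bij
    (fun w _ => Sum.elim (fun v => s(v, v + unitX K L)) (fun v => s(v, v + unitY K L)) w)
    ?_ ?_ ?_ ?_
  · rintro (v | v) - <;>
      simp [SimpleGraph.mem_edgeFinset, torus_adj_iff (K := K) (L := L) (by omega) (by omega)]
  · rintro (⟨a, b⟩ | ⟨a, b⟩) - (⟨c, d⟩ | ⟨c, d⟩) - h <;>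
      simp only [Sum.elim_inl, Sum.elim_inr, Sym2.eq_iff, Prod.mk_add_mk, Prod.mk.injEq,
        add_zero] at h
    · rcases h with ⟨⟨rfl, rfl⟩, -⟩ | ⟨⟨rfl, rfl⟩, h, -⟩
      · rfl
      · rw [add_assoc, add_eq_left] at h; exact absurd h x2
    · rcases h with ⟨⟨rfl, rfl⟩, h, -⟩ | ⟨⟨rfl, rfl⟩, h, -⟩
      · rw [add_eq_left] at h; exact absurd h x1
      · rw [add_eq_left] at h; exact absurd h x1
    · rcases h with ⟨⟨rfl, rfl⟩, -, h⟩ | ⟨⟨rfl, rfl⟩, -, h⟩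
      · rw [add_eq_left] at h; exact absurd h y1
      · rw [add_eq_left] at h; exact absurd h y1
    · rcases h with ⟨⟨rfl, rfl⟩, -⟩ | ⟨⟨rfl, rfl⟩, -, h⟩
      · rfl
      · rw [add_assoc, add_eq_left] at h; exact absurd h y2
  · intro e he
    induction e with
    | _ u v =>
    rw [SimpleGraph.mem_edgeFinset, SimpleGraph.mem_edgeSet,
      torus_adj_iff (by omega) (by omega)] at he
    rcases he with h | h | h | h
    · exact ⟨Sum.inl u, Finset.mem_univ _, by simp [h]⟩
    · exact ⟨Sum.inl v, Finset.mem_univ _, by simp [h]⟩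
    · exact ⟨Sum.inr u, Finset.mem_univ _, by simp [h]⟩
    · exact ⟨Sum.inr v, Finset.mem_univ _, by simp [h]⟩
  · rintro (v | v) - <;> rfl

theorem energy_eq {K L q : ℕ} [NeZero K] [NeZero L] (hK : 3 ≤ K) (hL : 3 ≤ L) (h : ℝ)
    (σ : Config K L q) :
    energy K L q h σ = -(∑ v, (agr (σ v) (σ (v + unitX K L)) + agr (σ v) (σ (v + unitY K L))))
      + h * ∑ v, one (σ v) := by
  unfold energy
  classical
  rw [sum_torus_edges hK hL]
  simp only [Sym2.map_mk, Sym2.mk_isDiag_iff, agr, one]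

/-! ### Single spin flips -/

theorem sum_agr_update {G : Type*} [AddCommGroup G] [Fintype G] [DecidableEq G] {q : ℕ} {e : G}
    (he : e ≠ 0) (σ : G → Spin q) (v : G) (c : Spin q) :
    ∑ u, agr (Function.update σ v c u) (Function.update σ v c (u + e))
      = ∑ u, agr (σ u) (σ (u + e)) - (agr (σ v) (σ (v + e)) - agr c (σ (v + e)))
        - (agr (σ v) (σ (v - e)) - agr c (σ (v - e))) := by
  have key : ∑ u, (agr (Function.update σ v c u) (Function.update σ v c (u + e))
      - agr (σ u) (σ (u + e))) = - (agr (σ v) (σ (v + e)) - agr c (σ (v + e)))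
        - (agr (σ v) (σ (v - e)) - agr c (σ (v - e))) := by
    have h1 : v ≠ v - e := by simpa [eq_sub_iff_add_eq] using he
    have h2 : v + e ≠ v := by simpa using he
    rw [Fintype.sum_eq_add v (v - e) h1]
    · rw [Function.update_self, Function.update_of_ne h2, Function.update_of_ne h1.symm,
        sub_add_cancel, Function.update_self, agr_comm c (σ (v - e)), agr_comm (σ v) (σ (v - e))]
      ring
    · rintro u ⟨hu, hu'⟩
      rw [Function.update_of_ne hu, Function.update_of_ne, sub_self]
      exact fun h => hu' (eq_sub_of_add_eq h)
  rw [Finset.sum_sub_distrib] at key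
  linarith

theorem sum_one_update {G : Type*} [Fintype G] [DecidableEq G] {q : ℕ} (σ : G → Spin q) (v : G)
    (c : Spin q) :
    ∑ u, one (Function.update σ v c u) = ∑ u, one (σ u) + (one c - one (σ v)) := by
  have key : ∑ u, (one (Function.update σ v c u) - one (σ u)) = one c - one (σ v) := by
    rw [Fintype.sum_eq_single v]
    · rw [Function.update_self]
    · intro u hu
      rw [Function.update_of_ne hu, sub_self]
  rw [Finset.sum_sub_distrib] at key
  linarith

/-- The pairs of perpendicular unit vectors. -/
def Perp {K L : ℕ} [NeZero K] [NeZero L] (e f : Fin K × Fin L) : Prop :=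
  ((e = unitX K L ∨ e = -unitX K L) ∧ (f = unitY K L ∨ f = -unitY K L)) ∨
  ((e = unitY K L ∨ e = -unitY K L) ∧ (f = unitX K L ∨ f = -unitX K L))

section Perp

variable {K L : ℕ} [NeZero K] [NeZero L] {e f : Fin K × Fin L}

theorem Perp.symm (hef : Perp e f) : Perp f e := by
  unfold Perp at *; tauto

theorem Perp.neg_right (hef : Perp e f) : Perp e (-f) := by
  rcases hef with ⟨he, rfl | rfl⟩ | ⟨he, rfl | rfl⟩
  · exact Or.inl ⟨he, Or.inr rfl⟩
  · exact Or.inl ⟨he, Or.inl (neg_neg _)⟩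
  · exact Or.inr ⟨he, Or.inr rfl⟩
  · exact Or.inr ⟨he, Or.inl (neg_neg _)⟩

theorem perp_unitX_unitY : Perp (unitX K L) (unitY K L) := Or.inl ⟨Or.inl rfl, Or.inl rfl⟩

theorem Perp.nsmul_ne (hK : 2 ≤ K) (hL : 2 ≤ L) (hef : Perp e f) (i j : ℕ) :
    i • e + f ≠ j • e := by
  have x1 : (1 : Fin K) ≠ 0 := by simpa using nsmul_one_ne_zero (K := K) one_pos (by omega)
  have y1 : (1 : Fin L) ≠ 0 := by simpa using nsmul_one_ne_zero (K := L) one_pos (by omega)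
  rcases hef with ⟨rfl | rfl, rfl | rfl⟩ | ⟨rfl | rfl, rfl | rfl⟩ <;>
    simp [Prod.ext_iff, x1, y1]

theorem addOrderOf_unitX : addOrderOf (unitX K L) = K := by
  refine (addOrderOf_eq_iff (NeZero.pos K)).2 ⟨?_, fun i hi h0 h => ?_⟩
  · refine Prod.ext (Fin.ext ?_) (by simp)
    simp [nsmul_one_val]
  · exact nsmul_one_ne_zero h0 hi (by simpa using congrArg Prod.fst h)

theorem addOrderOf_unitY : addOrderOf (unitY K L) = L := by
  refine (addOrderOf_eq_iff (NeZero.pos L)).2 ⟨?_, fun i hi h0 h => ?_⟩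
  · refine Prod.ext (by simp) (Fin.ext ?_)
    simp [nsmul_one_val]
  · exact nsmul_one_ne_zero h0 hi (by simpa using congrArg Prod.snd h)

theorem Perp.three_le_addOrderOf (hK : 3 ≤ K) (hL : 3 ≤ L) (hef : Perp e f) :
    3 ≤ addOrderOf e := by
  rcases hef with ⟨rfl | rfl, -⟩ | ⟨rfl | rfl, -⟩ <;>
    simpa only [addOrderOf_neg, addOrderOf_unitX, addOrderOf_unitY]

/-- The local energy change is invariant under signs and exchange of the axes. Allowing any
perpendicular pair lets one argument serve all four sides of a rectangle. -/
theorem energy_update {q : ℕ} (hK : 3 ≤ K) (hL : 3 ≤ L) (h : ℝ) (hef : Perp e f)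
    (σ : Config K L q) (v : Fin K × Fin L) (c : Spin q) :
    energy K L q h (Function.update σ v c) = energy K L q h σ
      + (agr (σ v) (σ (v + e)) - agr c (σ (v + e))) + (agr (σ v) (σ (v - e)) - agr c (σ (v - e)))
      + (agr (σ v) (σ (v + f)) - agr c (σ (v + f))) + (agr (σ v) (σ (v - f)) - agr c (σ (v - f)))
      + h * (one c - one (σ v)) := by
  have x1 : unitX K L ≠ 0 := by
    simpa [Prod.ext_iff] using nsmul_one_ne_zero (K := K) one_pos (by omega)
  have y1 : unitY K L ≠ 0 := by
    simpa [Prod.ext_iff] using nsmul_one_ne_zero (K := L) one_pos (by omega)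
  rw [energy_eq hK hL, energy_eq hK hL, sum_one_update, Finset.sum_add_distrib,
    Finset.sum_add_distrib, sum_agr_update x1, sum_agr_update y1]
  have s1 : ∀ w : Fin K × Fin L, v - -w = v + w := fun w => sub_neg_eq_add v w
  have s2 : ∀ w : Fin K × Fin L, v + -w = v - w := fun w => (sub_eq_add_neg v w).symm
  rcases hef with ⟨rfl | rfl, rfl | rfl⟩ | ⟨rfl | rfl, rfl | rfl⟩ <;>
    (try simp only [s1 (unitX K L), s1 (unitY K L), s2 (unitX K L), s2 (unitY K L)]) <;> ring

end Perp

end Potts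

namespace Potts

/-! ### Sweeps: successive flips along a segment -/

/-- `η` can be reached from `σ` by single spin flips through states of energy at most `C`. -/
def Reach {K L q : ℕ} (h C : ℝ) : Config K L q → Config K L q → Prop :=
  Relation.ReflTransGen fun a b => energy K L q h b ≤ C ∧ ∃ v c, b = Function.update a v c

/-- The vertices `x, x + e, …, x + (k - 1) e` receive the spins of their `p`-neighbours. -/
def sweep {K L q : ℕ} [NeZero K] [NeZero L] (σ : Config K L q) (x e p : Fin K × Fin L) :
    ℕ → Config K L q
  | 0 => σ
  | k + 1 => Function.update (sweep σ x e p k) (x + k • e) (σ (x + k • e + p))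

/-- The spin behind the `k`-th vertex of a sweep at the time this vertex is flipped. -/
def sweepPrev {K L q : ℕ} [NeZero K] [NeZero L] (σ : Config K L q) (x e p : Fin K × Fin L) :
    ℕ → Spin q
  | 0 => σ (x - e)
  | k + 1 => σ (x + k • e + p)

section Sweep

variable {K L q : ℕ} [NeZero K] [NeZero L] {h : ℝ} {σ : Config K L q} {x e p : Fin K × Fin L}

theorem sweep_of_ne {k : ℕ} {v : Fin K × Fin L} (hv : ∀ j < k, v ≠ x + j • e) :
    sweep σ x e p k v = σ v := by
  induction k with
  | zero => rfl
  | succ k ih =>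
    rw [sweep, Function.update_of_ne (hv k (Nat.lt_succ_self k))]
    exact ih fun j hj => hv j (by omega)

theorem add_nsmul_ne {i j : ℕ} (hij : i ≠ j) (hi : i < addOrderOf e) (hj : j < addOrderOf e) :
    x + i • e ≠ x + j • e := fun h' =>
  hij (nsmul_injOn_Iio_addOrderOf hi hj (add_left_cancel h'))

theorem sweep_apply {j k : ℕ} (hjk : j < k) (hk : k ≤ addOrderOf e) :
    sweep σ x e p k (x + j • e) = σ (x + j • e + p) := by
  induction k with
  | zero => omega
  | succ k ih =>
    rw [sweep]
    by_cases hj : j = k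
    · subst hj; rw [Function.update_self]
    · rw [Function.update_of_ne (add_nsmul_ne hj (by omega) (by omega))]
      exact ih (by omega) (by omega)

/-- The bound on `k` keeps the sweep from closing up around the torus: the vertex ahead still has
its original spin, and only the one behind may have been flipped. -/
theorem energy_sweep_succ (hK : 3 ≤ K) (hL : 3 ≤ L) (hep : Perp e p) {k : ℕ}
    (hk : k + 1 < addOrderOf e) :
    energy K L q h (sweep σ x e p (k + 1)) = energy K L q h (sweep σ x e p k)
      + (agr (σ (x + k • e)) (σ (x + (k + 1) • e))
          - agr (σ (x + k • e + p)) (σ (x + (k + 1) • e)))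
      + (agr (σ (x + k • e)) (sweepPrev σ x e p k)
          - agr (σ (x + k • e + p)) (sweepPrev σ x e p k))
      + (agr (σ (x + k • e)) (σ (x + k • e + p)) - 1)
      + (agr (σ (x + k • e)) (σ (x + k • e - p)) - agr (σ (x + k • e + p)) (σ (x + k • e - p)))
      + h * (one (σ (x + k • e + p)) - one (σ (x + k • e))) := by
  have h0 : sweep σ x e p k (x + k • e) = σ (x + k • e) :=
    sweep_of_ne fun j hj => add_nsmul_ne (by omega) (by omega) (by omega)
  have h1 : sweep σ x e p k (x + k • e + e) = σ (x + (k + 1) • e) := by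
    rw [add_assoc, ← succ_nsmul]
    exact sweep_of_ne fun j hj => add_nsmul_ne (by omega) (by omega) (by omega)
  have h2 : sweep σ x e p k (x + k • e - e) = sweepPrev σ x e p k := by
    cases k with
    | zero => simp [sweep, sweepPrev]
    | succ k =>
      have : x + (k + 1) • e - e = x + k • e := by rw [succ_nsmul]; abel
      rw [this, sweepPrev]
      exact sweep_apply (by omega) (by omega)
  have h3 : sweep σ x e p k (x + k • e + p) = σ (x + k • e + p) :=
    sweep_of_ne fun j hj h' => hep.nsmul_ne (by omega) (by omega) k j
      (add_left_cancel (a := x) (by rw [← h']; abel))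
  have h4 : sweep σ x e p k (x + k • e - p) = σ (x + k • e - p) :=
    sweep_of_ne fun j hj h' => hep.neg_right.nsmul_ne (by omega) (by omega) k j
      (add_left_cancel (a := x) (by rw [← h']; abel))
  rw [sweep, energy_update hK hL h hep, h0, h1, h2, h3, h4, agr_self]

theorem reach_sweep {C : ℝ} {m : ℕ} (hC : ∀ k < m, energy K L q h (sweep σ x e p (k + 1)) ≤ C) :
    Reach h C σ (sweep σ x e p m) := by
  induction m with
  | zero => exact Relation.ReflTransGen.refl
  | succ m ih =>
    exact (ih fun k hk => hC k (by omega)).tail ⟨hC m (Nat.lt_succ_self m), _, _, rfl⟩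

/-- Growth of a phase `s` (of spin different from `1`) along a segment on its side. -/
theorem energy_sweep_expand_le (hK : 3 ≤ K) (hL : 3 ≤ L) (hep : Perp e p) {s : Spin q}
    (hs : (s : ℕ) ≠ 1) {k : ℕ} (hk : k + 1 < addOrderOf e)
    (hside : ∀ i ≤ k, σ (x + i • e + p) = s) (hne : ∀ i ≤ k, σ (x + i • e) ≠ s) :
    energy K L q h (sweep σ x e p (k + 1)) ≤ energy K L q h σ + 2 - dis (σ (x - e)) (σ x)
      - ∑ i ∈ Finset.range (k + 1),
        (dis (σ (x + i • e)) (σ (x + (i + 1) • e)) + h * one (σ (x + i • e))) := by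
  induction k with
  | zero =>
    have h1 := energy_sweep_succ (h := h) (σ := σ) (x := x) hK hL hep hk
    have h2 := hside 0 le_rfl
    have h3 := hne 0 le_rfl
    have h4 := agr_nonneg s (σ (x + (0 + 1) • e))
    have h5 := agr_nonneg s (sweepPrev σ x e p 0)
    have h6 := agr_nonneg s (σ (x + 0 • e - p))
    have h7 := agr_le_one (σ (x + 0 • e)) (σ (x + 0 • e - p))
    rw [h2, one_of_ne hs, agr_of_ne h3, agr_eq _ (σ (x + (0 + 1) • e)),
      agr_eq _ (sweepPrev σ x e p 0), dis_comm _ (sweepPrev σ x e p 0)] at h1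
    rw [Finset.sum_range_one]
    simp only [sweepPrev, sweep, zero_smul, add_zero] at *
    linarith
  | succ k ih =>
    -- The first flip gains one bond and loses at most three. Every later one gains two, at its side
    -- and behind, and loses at most two, so only the first flip can raise the energy.
    have h0 := ih (by omega) (fun i hi => hside i (by omega)) (fun i hi => hne i (by omega))
    have h1 := energy_sweep_succ (h := h) (σ := σ) (x := x) hK hL hep hk
    have h2 := hside (k + 1) le_rfl
    have h3 := hne (k + 1) le_rfl
    have h4 := agr_nonneg s (σ (x + (k + 1 + 1) • e))
    have h6 := agr_nonneg s (σ (x + (k + 1) • e - p))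
    have h7 := agr_le_one (σ (x + (k + 1) • e)) (σ (x + (k + 1) • e - p))
    rw [h2, one_of_ne hs, agr_of_ne h3, sweepPrev, hside k (by omega), agr_of_ne h3, agr_self,
      agr_eq _ (σ (x + (k + 1 + 1) • e))] at h1
    rw [Finset.sum_range_succ]
    linarith

/-- Consumption of a segment of spin `s` by the phases on its side, before the last flip. -/
theorem energy_sweep_eat_le (hK : 3 ≤ K) (hL : 3 ≤ L) (hep : Perp e p) {s : Spin q}
    (hs : (s : ℕ) ≠ 1) {k : ℕ} (hk : k < addOrderOf e) (hseg : ∀ i ≤ k, σ (x + i • e) = s)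
    (hne : ∀ i < k, σ (x + i • e + p) ≠ s) (hl : σ (x - e) ≠ s) :
    energy K L q h (sweep σ x e p k) ≤ energy K L q h σ
      + ∑ i ∈ Finset.range k, (dis (σ (x + i • e + p)) (sweepPrev σ x e p i)
        + h * one (σ (x + i • e + p)) - dis s (σ (x + i • e - p))) := by
  induction k with
  | zero => simp [sweep]
  | succ k ih =>
    have h0 := ih (by omega) (fun i hi => hseg i (by omega)) (fun i hi => hne i (by omega))
    -- The lost bond ahead is balanced by the new bond at the side, and the bond behind is already
    -- broken; what remains is a possible new disagreement behind, the field and the opposite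
    -- neighbour.
    have h1 := energy_sweep_succ (h := h) (σ := σ) (x := x) hK hL hep hk
    have h2 := hne k (by omega)
    have h3 : sweepPrev σ x e p k ≠ s := by
      cases k with
      | zero => exact hl
      | succ k => exact hne k (by omega)
    have h6 := agr_nonneg (σ (x + k • e + p)) (σ (x + k • e - p))
    rw [hseg k (by omega), hseg (k + 1) le_rfl, agr_self, agr_of_ne h2, agr_of_ne h2.symm,
      agr_of_ne h3.symm, one_of_ne hs, agr_eq s, agr_eq _ (sweepPrev σ x e p k)] at h1
    rw [Finset.sum_range_succ]
    linarith

/-- Consumption of a whole segment of spin `s` by the phases on its side. -/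
theorem energy_sweep_eat_last_le (hK : 3 ≤ K) (hL : 3 ≤ L) (hep : Perp e p) {s : Spin q}
    (hs : (s : ℕ) ≠ 1) {m : ℕ} (hm : m + 1 < addOrderOf e) (hseg : ∀ i ≤ m, σ (x + i • e) = s)
    (hne : ∀ i ≤ m, σ (x + i • e + p) ≠ s) (hl : σ (x - e) ≠ s)
    (hr : σ (x + (m + 1) • e) ≠ s) :
    energy K L q h (sweep σ x e p (m + 1)) ≤ energy K L q h σ
      + ∑ i ∈ Finset.range (m + 1), (dis (σ (x + i • e + p)) (sweepPrev σ x e p i)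
        + h * one (σ (x + i • e + p)) - dis s (σ (x + i • e - p)))
      + dis (σ (x + m • e + p)) (σ (x + (m + 1) • e)) - 2 := by
  have h0 := energy_sweep_eat_le (h := h) hK hL hep hs (by omega) hseg
    (fun i hi => hne i (by omega)) hl
  -- The last vertex has no `s` ahead, so it loses no bond there and may gain one; this is the
  -- source of `dis _ _ - 2`.
  have h1 := energy_sweep_succ (h := h) (σ := σ) (x := x) hK hL hep hm
  have h2 := hne m (by omega)
  have h3 : sweepPrev σ x e p m ≠ s := by
    cases m with
    | zero => exact hl
    | succ k => exact hne k (by omega)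
  have h6 := agr_nonneg (σ (x + m • e + p)) (σ (x + m • e - p))
  rw [hseg m (by omega), agr_of_ne hr.symm, agr_of_ne h2.symm,
    agr_of_ne h3.symm, one_of_ne hs, agr_eq s, agr_eq _ (sweepPrev σ x e p m),
    agr_eq _ (σ (x + (m + 1) • e))] at h1
  rw [Finset.sum_range_succ]
  linarith

end Sweep

end Potts

namespace Potts

/-! ### Extremal configurations -/

/-- The number of vertices of spin `s`. -/
def spinCount {K L q : ℕ} (s : Spin q) (σ : Config K L q) : ℕ :=
  (Finset.univ.filter fun v => σ v = s).card

/-- Within the energy barrier `2`, no state of lower energy can be reached from `σ`, and no state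
of the same energy with more vertices of spin `s`. -/
structure Extremal {K L q : ℕ} (h : ℝ) (s : Spin q) (σ : Config K L q) : Prop where
  energy_le : ∀ τ, Reach h (energy K L q h σ + 2) σ τ → energy K L q h σ ≤ energy K L q h τ
  count_le : ∀ τ, Reach h (energy K L q h σ + 2) σ τ → energy K L q h τ ≤ energy K L q h σ →
    spinCount s τ ≤ spinCount s σ

theorem Reach.mono {K L q : ℕ} {h C C' : ℝ} {σ τ : Config K L q} (hr : Reach h C σ τ)
    (hC : C ≤ C') : Reach h C' σ τ :=
  Relation.ReflTransGen.mono (fun _ _ hab => ⟨hab.1.trans hC, hab.2⟩) _ _ hr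

theorem spinCount_lt {K L q : ℕ} {s : Spin q} {σ τ : Config K L q}
    (hsub : ∀ v, σ v = s → τ v = s) {w : Fin K × Fin L} (hw : σ w ≠ s) (hw' : τ w = s) :
    spinCount s σ < spinCount s τ := by
  refine Finset.card_lt_card ⟨fun v hv => ?_, fun hss => hw ?_⟩
  · simp only [Finset.mem_filter, Finset.mem_univ, true_and] at hv ⊢
    exact hsub v hv
  · have := hss (show w ∈ _ by simp [hw'])
    simpa using this

/-- The form in which maximality of the count is used: growing the phase `s` must cost energy
strictly, even where plain minimality would allow a tie. -/
theorem Extremal.lt_energy_of_grow {K L q : ℕ} {h : ℝ} {s : Spin q}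
    {σ τ : Config K L q} (hσ : Extremal h s σ)
    (hr : Reach h (energy K L q h σ + 2) σ τ) (hsub : ∀ v, σ v = s → τ v = s)
    {w : Fin K × Fin L} (hw : σ w ≠ s) (hw' : τ w = s) :
    energy K L q h σ < energy K L q h τ := by
  by_contra hle
  exact absurd (hσ.count_le τ hr (not_lt.1 hle)) (not_le.2 (spinCount_lt hsub hw hw'))

theorem agr_add_agr_le {q : ℕ} {a b : Spin q} (hab : a ≠ b) (c : Spin q) :
    agr a c + agr b c ≤ 1 := by
  by_cases hac : a = c
  · subst hac; rw [agr_self, agr_of_ne hab.symm]; norm_num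
  · rw [agr_of_ne hac, zero_add]; exact agr_le_one b c

section Extremal

variable {K L q : ℕ} [NeZero K] [NeZero L] {h : ℝ} {s : Spin q} {σ : Config K L q}
  {e f : Fin K × Fin L}

/-- A vertex outside the phase `s` of an extremal configuration has at most one neighbour in it. -/
theorem Extremal.sum_agr_lt (hK : 3 ≤ K) (hL : 3 ≤ L) (h0 : 0 ≤ h) (hs : (s : ℕ) ≠ 1)
    (hσ : Extremal h s σ) (hef : Perp e f) {v : Fin K × Fin L} (hv : σ v ≠ s) :
    agr s (σ (v + e)) + agr s (σ (v - e)) + agr s (σ (v + f)) + agr s (σ (v - f)) < 2 := by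
  by_contra hge
  have hE := energy_update (h := h) hK hL hef σ v s
  -- Turning `v` into `s` costs at most `1 - 2 * agr s _` per neighbour, hence at most zero in total
  -- when two neighbours are `s`.
  have h1 := agr_add_agr_le hv (σ (v + e))
  have h2 := agr_add_agr_le hv (σ (v - e))
  have h3 := agr_add_agr_le hv (σ (v + f))
  have h4 := agr_add_agr_le hv (σ (v - f))
  have h5 := mul_nonneg h0 (one_nonneg (σ v))
  rw [one_of_ne hs] at hE
  refine absurd (hσ.lt_energy_of_grow (τ := Function.update σ v s)
    (.single ⟨by linarith, v, s, rfl⟩) (fun u hu => ?_) hv (Function.update_self _ _ _))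
    (by linarith)
  by_cases huv : u = v
  · rw [huv, Function.update_self]
  · rw [Function.update_of_ne huv, hu]

theorem Extremal.ne_of_perp (hK : 3 ≤ K) (hL : 3 ≤ L) (h0 : 0 ≤ h) (hs : (s : ℕ) ≠ 1)
    (hσ : Extremal h s σ) (hef : Perp e f) {v : Fin K × Fin L} (hv : σ v ≠ s)
    (he : σ (v + e) = s) : σ (v + f) ≠ s := by
  intro hf
  have := hσ.sum_agr_lt hK hL h0 hs hef hv
  rw [he, hf, agr_self] at this
  linarith [agr_nonneg s (σ (v - e)), agr_nonneg s (σ (v - f))]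

/-- A phase containing a segment contains all or nothing of the neighbouring segment. -/
theorem Extremal.side_eq (hK : 3 ≤ K) (hL : 3 ≤ L) (h0 : 0 ≤ h) (hs : (s : ℕ) ≠ 1)
    (hσ : Extremal h s σ) (hef : Perp e f) {o : Fin K × Fin L} {m i : ℕ} (hi : i ≤ m)
    (hrow : ∀ j ≤ m, σ (o + j • e) = s) (his : σ (o + i • e + f) = s) :
    ∀ j ≤ m, σ (o + j • e + f) = s := by
  have step : ∀ j < m, (σ (o + j • e + f) = s ↔ σ (o + (j + 1) • e + f) = s) := by
    intro j hj
    have e1 : o + (j + 1) • e + f - f = o + (j + 1) • e := by abel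
    have e2 : o + (j + 1) • e + f + -e = o + j • e + f := by rw [succ_nsmul]; abel
    have e3 : o + j • e + f + -f = o + j • e := by abel
    have e4 : o + j • e + f + e = o + (j + 1) • e + f := by rw [succ_nsmul]; abel
    constructor
    · intro hjs
      by_contra hne
      refine hσ.ne_of_perp hK hL h0 hs hef.symm.neg_right.symm.neg_right hne (by rw [e2, hjs]) ?_
      rw [← sub_eq_add_neg, e1, hrow _ hj]
    · intro hjs
      by_contra hne
      refine hσ.ne_of_perp hK hL h0 hs hef.neg_right hne (by rw [e4, hjs]) ?_
      rw [e3, hrow _ hj.le]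
  have all : ∀ j ≤ m, (σ (o + j • e + f) = s ↔ σ (o + 0 • e + f) = s) := by
    intro j
    induction j with
    | zero => simp
    | succ j ih => intro hj; rw [← step j (by omega), ih (by omega)]
  exact fun j hj => (all j hj).2 ((all i hi).1 his)

theorem sweep_eq_of_side {x p : Fin K × Fin L} {k : ℕ} (hk : k ≤ addOrderOf e)
    (hside : ∀ i < k, σ (x + i • e + p) = s) {v : Fin K × Fin L} (hv : σ v = s) :
    sweep σ x e p k v = s := by
  by_cases hvx : ∃ j < k, v = x + j • e
  · obtain ⟨j, hj, rfl⟩ := hvx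
    rw [sweep_apply hj hk, hside j hj]
  · push Not at hvx
    rw [sweep_of_ne hvx, hv]

/-- A phase containing a full line contains the neighbouring line. -/
theorem Extremal.line_eq (hK : 3 ≤ K) (hL : 3 ≤ L) (h0 : 0 ≤ h) (hs : (s : ℕ) ≠ 1)
    (hσ : Extremal h s σ) (hef : Perp e f) {o : Fin K × Fin L}
    (hrow : ∀ j : ℕ, σ (o + j • e) = s) (j : ℕ) : σ (o + f + j • e) = s := by
  by_contra hj
  have h3 := hef.three_le_addOrderOf hK hL
  -- The sweep fills `m + 1` vertices, all but one of the line; the closing vertex sees `s` on both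
  -- sides and is flipped separately.
  obtain ⟨m, hm⟩ : ∃ m, addOrderOf e = m + 2 := ⟨addOrderOf e - 2, by omega⟩
  have hne : ∀ i : ℕ, σ (o + f + j • e + i • e) ≠ s := by
    intro i his
    have e1 : o + f + j • e + i • e = o + (j + i) • e + f := by rw [add_nsmul]; abel
    have e2 : o + f + j • e = o + j • e + f := by abel
    rw [e2] at hj
    exact hj (hσ.side_eq hK hL h0 hs hef (m := j + i) le_rfl (fun t _ => hrow t)
      (by rw [← e1, his]) j (by omega))
  set x := o + f + j • e with hx
  have hside : ∀ i : ℕ, σ (x + i • e + -f) = s := by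
    intro i
    have e1 : x + i • e + -f = o + (j + i) • e := by rw [hx, add_nsmul]; abel
    rw [e1, hrow]
  have hen : ∀ k ≤ m, energy K L q h (sweep σ x e (-f) (k + 1)) ≤ energy K L q h σ + 2 := by
    intro k hk
    have := energy_sweep_expand_le (h := h) (σ := σ) (x := x) hK hL hef.neg_right hs (k := k)
      (by omega) (fun i _ => hside i) (fun i _ => hne i)
    have h1 : 0 ≤ ∑ i ∈ Finset.range (k + 1),
        (dis (σ (x + i • e)) (σ (x + (i + 1) • e)) + h * one (σ (x + i • e))) :=
      Finset.sum_nonneg fun i _ => add_nonneg (dis_nonneg _ _) (mul_nonneg h0 (one_nonneg _))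
    linarith [dis_nonneg (σ (x - e)) (σ x)]
  have hreach : Reach h (energy K L q h σ + 2) σ (sweep σ x e (-f) (m + 1)) :=
    reach_sweep fun k hk => hen k (by omega)
  set τ := sweep σ x e (-f) (m + 1) with hτ
  have hτsub : ∀ v, σ v = s → τ v = s := fun v hv =>
    sweep_eq_of_side (by omega) (fun i _ => hside i) hv
  have hτrow : ∀ i ≤ m, τ (x + i • e) = s := fun i hi => by
    rw [hτ, sweep_apply (by omega) (by omega), hside]
  have hw : τ (x + (m + 1) • e) = σ (x + (m + 1) • e) :=
    sweep_of_ne fun i hi => add_nsmul_ne (by omega) (by omega) (by omega)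
  have hwne : τ (x + (m + 1) • e) ≠ s := by rw [hw]; exact hne _
  set w := x + (m + 1) • e with hwdef
  have hw1 : τ (w + e) = s := by
    have : w + e = x + 0 • e := by
      rw [hwdef, add_assoc, ← succ_nsmul, ← hm, addOrderOf_nsmul_eq_zero, zero_nsmul]
    rw [this]; exact hτrow 0 (by omega)
  have hw2 : τ (w - e) = s := by
    have : w - e = x + m • e := by rw [hwdef, succ_nsmul]; abel
    rw [this]; exact hτrow m le_rfl
  have hw3 : τ (w - f) = s := hτsub _ (by rw [sub_eq_add_neg]; exact hside (m + 1))
  -- Three bonds are gained and at most one is lost, which repays the 2 spent in starting the line.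
  have hE := energy_update (h := h) hK hL hef τ w s
  rw [hw1, hw2, hw3, agr_self, agr_of_ne hwne, one_of_ne hs] at hE
  have hE' := hen m le_rfl
  rw [← hτ] at hE'
  have h5 := mul_nonneg h0 (one_nonneg (τ w))
  have h6 := agr_le_one (τ w) (τ (w + f))
  have h7 := agr_nonneg s (τ (w + f))
  refine absurd (hσ.lt_energy_of_grow (τ := Function.update τ w s)
    (hreach.tail ⟨by linarith, w, s, rfl⟩) (fun u hu => ?_) (hne (m + 1))
    (Function.update_self _ _ _)) (by linarith)
  by_cases huw : u = w
  · rw [huw, Function.update_self]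
  · rw [Function.update_of_ne huw, hτsub u hu]

theorem Extremal.eq_const_of_line (hK : 3 ≤ K) (hL : 3 ≤ L) (h0 : 0 ≤ h) (hs : (s : ℕ) ≠ 1)
    (hσ : Extremal h s σ) (hef : Perp e f) {o : Fin K × Fin L}
    (hrow : ∀ j : ℕ, σ (o + j • e) = s) : ∀ i j : ℕ, σ (o + i • e + j • f) = s := by
  intro i j
  have : ∀ j : ℕ, ∀ i : ℕ, σ (o + j • f + i • e) = s := by
    intro j
    induction j with
    | zero => simpa using hrow
    | succ j ih =>
      rw [succ_nsmul, ← add_assoc]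
      exact hσ.line_eq hK hL h0 hs hef ih
  rw [add_right_comm]
  exact this j i

theorem exists_eq_add_nsmul (o v : Fin K × Fin L) :
    ∃ i j : ℕ, v = o + i • unitX K L + j • unitY K L := by
  refine ⟨(v - o).1.val, (v - o).2.val, ?_⟩
  have : v - o = (v - o).1.val • unitX K L + (v - o).2.val • unitY K L := by
    refine Prod.ext (Fin.ext ?_) (Fin.ext ?_)
    · simp [nsmul_one_val, Nat.mod_eq_of_lt (Fin.is_lt _)]
    · simp [nsmul_one_val, Nat.mod_eq_of_lt (Fin.is_lt _)]
  rw [add_assoc, ← this]; abel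

end Extremal

end Potts

namespace Potts

/-! ### Rectangular blocks -/

/-- A rectangle of `(m + 1) × (n + 1)` vertices `o + i e + j f`. -/
structure Frame (K L : ℕ) where
  o : Fin K × Fin L
  e : Fin K × Fin L
  f : Fin K × Fin L
  m : ℕ
  n : ℕ

namespace Frame

variable {K L q : ℕ} [NeZero K] [NeZero L]

/-- The same rectangle, turned by a right angle. -/
def rotate (F : Frame K L) : Frame K L := ⟨F.o + F.m • F.e, F.f, -F.e, F.n, F.m⟩

/-- The `i`-th spin along the base, outside of the rectangle. -/
def base (σ : Config K L q) (F : Frame K L) (i : ℕ) : Spin q := σ (F.o - F.f + i • F.e)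

/-- The spin at the outer corner before the base. -/
def corner (σ : Config K L q) (F : Frame K L) : Spin q := σ (F.o - F.f - F.e)

/-- The number of changes of spin along the base. -/
noncomputable def changes (σ : Config K L q) (F : Frame K L) : ℝ :=
  ∑ i ∈ Finset.range F.m, dis (F.base σ i) (F.base σ (i + 1))

/-- The number of spins `1` along the base. -/
noncomputable def ones (σ : Config K L q) (F : Frame K L) : ℝ :=
  ∑ i ∈ Finset.range (F.m + 1), one (F.base σ i)

theorem ones_nonneg (σ : Config K L q) (F : Frame K L) : 0 ≤ F.ones σ :=
  Finset.sum_nonneg fun _ _ => one_nonneg _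

theorem base_eq_of_changes_lt {σ : Config K L q} {F : Frame K L} (hF : F.changes σ < 1) {i : ℕ}
    (hi : i ≤ F.m) : F.base σ i = F.base σ 0 := by
  induction i with
  | zero => rfl
  | succ i ih =>
    rw [← ih (by omega)]
    by_contra hne
    have h1 : dis (F.base σ i) (F.base σ (i + 1)) ≤ F.changes σ :=
      Finset.single_le_sum (f := fun i => dis (F.base σ i) (F.base σ (i + 1)))
        (fun _ _ => dis_nonneg _ _) (Finset.mem_range.2 (by omega))
    rw [dis_of_ne (Ne.symm hne)] at h1
    linarith

/-- The rectangle is filled by the spin `s` and there is no such spin along its sides. -/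
structure IsBlock (σ : Config K L q) (s : Spin q) (F : Frame K L) : Prop where
  perp : Perp F.e F.f
  width : F.m + 1 < addOrderOf F.e
  height : F.n + 1 < addOrderOf F.f
  cells : ∀ i ≤ F.m, ∀ j ≤ F.n, σ (F.o + i • F.e + j • F.f) = s
  bottom : ∀ i ≤ F.m, σ (F.o + i • F.e - F.f) ≠ s
  top : ∀ i ≤ F.m, σ (F.o + i • F.e + (F.n + 1) • F.f) ≠ s
  left : ∀ j ≤ F.n, σ (F.o - F.e + j • F.f) ≠ s
  right : ∀ j ≤ F.n, σ (F.o + (F.m + 1) • F.e + j • F.f) ≠ s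

theorem IsBlock.rotate {σ : Config K L q} {s : Spin q} {F : Frame K L} (hF : IsBlock σ s F) :
    IsBlock σ s F.rotate := by
  obtain ⟨o, e, f, m, n⟩ := F
  obtain ⟨perp, width, height, cells, bottom, top, left, right⟩ := hF
  simp only at *
  have hsub : ∀ j ≤ m, ∀ v : Fin K × Fin L, v + m • e + j • (-e) = v + (m - j) • e := by
    intro j hj v
    obtain ⟨t, rfl⟩ := Nat.exists_eq_add_of_le hj
    rw [Nat.add_sub_cancel_left, add_nsmul, smul_neg]; abel
  refine ⟨perp.symm.neg_right, height, by simpa [Frame.rotate] using width, ?_, ?_, ?_, ?_, ?_⟩ <;>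
    simp only [Frame.rotate]
  · intro i hi j hj
    have : o + m • e + i • f + j • (-e) = o + (m - j) • e + i • f := by
      rw [add_right_comm (o + m • e), hsub j hj]
    rw [this]; exact cells _ (by omega) _ hi
  · intro i hi
    have : o + m • e + i • f - -e = o + (m + 1) • e + i • f := by rw [succ_nsmul]; abel
    rw [this]; exact right i hi
  · intro i hi
    have : o + m • e + i • f + (m + 1) • (-e) = o - e + i • f := by
      rw [succ_nsmul, smul_neg]; abel
    rw [this]; exact left i hi
  · intro j hj
    have : o + m • e - f + j • (-e) = o + (m - j) • e - f := by
      rw [← hsub j hj]; abel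
    rw [this]; exact bottom _ (by omega)
  · intro j hj
    have : o + m • e + (n + 1) • f + j • (-e) = o + (m - j) • e + (n + 1) • f := by
      rw [← hsub j hj]; abel
    rw [this]; exact top _ (by omega)

theorem base_rotate_zero (σ : Config K L q) (F : Frame K L) :
    F.rotate.base σ 0 = σ (F.o + (F.m + 1) • F.e) := by
  simp only [base, Frame.rotate]
  congr 1; rw [succ_nsmul]; abel

theorem corner_rotate (σ : Config K L q) (F : Frame K L) :
    F.rotate.corner σ = F.base σ (F.m + 1) := by
  simp only [base, corner, Frame.rotate]
  congr 1; rw [succ_nsmul]; abel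

theorem rotate_behind (σ : Config K L q) (F : Frame K L) :
    σ (F.rotate.o - F.rotate.e) = F.base σ F.m := by
  simp only [base, Frame.rotate]
  congr 1; abel

/-- In an extremal configuration a block cannot be enlarged. -/
theorem IsBlock.expand_lt (hK : 3 ≤ K) (hL : 3 ≤ L) {h : ℝ} (h0 : 0 ≤ h) {s : Spin q}
    (hs : (s : ℕ) ≠ 1) {σ : Config K L q} (hσ : Extremal h s σ) {F : Frame K L}
    (hF : IsBlock σ s F) :
    F.changes σ + dis (F.corner σ) (F.base σ 0) + dis (F.base σ F.m) (F.rotate.corner σ)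
      + h * F.ones σ < 2 := by
  by_contra hge
  have hside : ∀ i ≤ F.m, σ (F.o - F.f + i • F.e + F.f) = s := by
    intro i hi
    have : F.o - F.f + i • F.e + F.f = F.o + i • F.e + 0 • F.f := by rw [zero_nsmul]; abel
    rw [this]; exact hF.cells i hi 0 (by omega)
  have hne : ∀ i ≤ F.m, σ (F.o - F.f + i • F.e) ≠ s := by
    intro i hi
    have : F.o - F.f + i • F.e = F.o + i • F.e - F.f := by abel
    rw [this]; exact hF.bottom i hi
  have hen : ∀ k ≤ F.m, _ := fun k hk => energy_sweep_expand_le (h := h) (σ := σ)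
    (x := F.o - F.f) hK hL hF.perp hs (k := k) (by have := hF.width; omega)
    (fun i hi => hside i (by omega)) (fun i hi => hne i (by omega))
  have hpos : ∀ k, 0 ≤ ∑ i ∈ Finset.range (k + 1), (dis (σ (F.o - F.f + i • F.e))
      (σ (F.o - F.f + (i + 1) • F.e)) + h * one (σ (F.o - F.f + i • F.e))) := fun k =>
    Finset.sum_nonneg fun i _ => add_nonneg (dis_nonneg _ _) (mul_nonneg h0 (one_nonneg _))
  have hd := dis_nonneg (σ (F.o - F.f - F.e)) (σ (F.o - F.f))
  have hlt := hσ.lt_energy_of_grow (τ := sweep σ (F.o - F.f) F.e F.f (F.m + 1))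
    (reach_sweep fun k hk => by linarith [hen k (by omega), hpos k])
    (fun v hv => sweep_eq_of_side (by have := hF.width; omega)
      (fun i hi => hside i (by omega)) hv) (hne 0 (by omega))
    (by rw [sweep_apply (by omega) (by have := hF.width; omega)]; exact hside 0 (by omega))
  have hm := hen F.m le_rfl
  rw [Finset.sum_add_distrib, ← Finset.mul_sum, Finset.sum_range_succ] at hm
  rw [corner_rotate] at hge
  simp only [changes, ones, corner, base, zero_smul, add_zero] at hge
  linarith

/-- In an extremal configuration the phases along the base cannot consume the bottom line of a
block. -/
theorem IsBlock.le_eat (hK : 3 ≤ K) (hL : 3 ≤ L) {h : ℝ} (h0 : 0 ≤ h) {s : Spin q}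
    (hs : (s : ℕ) ≠ 1) {σ : Config K L q} (hσ : Extremal h s σ) {F : Frame K L}
    (hF : IsBlock σ s F) :
    2 ≤ F.changes σ + dis (σ (F.o - F.e)) (F.base σ 0) + dis (F.base σ F.m) (F.rotate.base σ 0)
      + h * F.ones σ := by
  by_contra! hlt
  rw [base_rotate_zero] at hlt
  have hb : ∀ i : ℕ, σ (F.o + i • F.e + -F.f) = F.base σ i := fun i => by
    rw [base]; congr 1; abel
  have hseg : ∀ i ≤ F.m, σ (F.o + i • F.e) = s := fun i hi => by
    simpa using hF.cells i hi 0 (by omega)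
  have hne : ∀ i ≤ F.m, σ (F.o + i • F.e + -F.f) ≠ s := fun i hi => by
    rw [← sub_eq_add_neg]; exact hF.bottom i hi
  have hl : σ (F.o - F.e) ≠ s := by simpa using hF.left 0 (by omega)
  have hr : σ (F.o + (F.m + 1) • F.e) ≠ s := by simpa using hF.right 0 (by omega)
  have hw := hF.width
  have hsum : ∑ i ∈ Finset.range (F.m + 1), (dis (F.base σ i) (sweepPrev σ F.o F.e (-F.f) i)
      + h * one (F.base σ i))
      = F.changes σ + dis (σ (F.o - F.e)) (F.base σ 0) + h * F.ones σ := by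
    rw [Finset.sum_add_distrib, ← Finset.mul_sum, Finset.sum_range_succ', changes, ones]
    congr 2
    · refine Finset.sum_congr rfl fun i _ => ?_
      rw [sweepPrev, hb, dis_comm]
    · rw [sweepPrev, dis_comm]
  have hpart : ∀ k ≤ F.m, energy K L q h (sweep σ F.o F.e (-F.f) k) ≤ energy K L q h σ
      + ∑ i ∈ Finset.range (F.m + 1), (dis (F.base σ i) (sweepPrev σ F.o F.e (-F.f) i)
        + h * one (F.base σ i)) := by
    intro k hk
    refine (energy_sweep_eat_le (h := h) hK hL hF.perp.neg_right hs (k := k) (by omega)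
      (fun i hi => hseg i (by omega)) (fun i hi => hne i (by omega)) hl).trans ?_
    gcongr
    refine (Finset.sum_le_sum (fun i _ => ?_)).trans (Finset.sum_le_sum_of_subset_of_nonneg
      (Finset.range_mono (show k ≤ F.m + 1 by omega)) fun i _ _ =>
        add_nonneg (dis_nonneg _ _) (mul_nonneg h0 (one_nonneg _)))
    rw [hb]
    linarith [dis_nonneg s (σ (F.o + i • F.e - -F.f))]
  have hlast : energy K L q h (sweep σ F.o F.e (-F.f) (F.m + 1)) ≤ energy K L q h σ
      + ∑ i ∈ Finset.range (F.m + 1), (dis (F.base σ i) (sweepPrev σ F.o F.e (-F.f) i)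
        + h * one (F.base σ i)) + dis (F.base σ F.m) (σ (F.o + (F.m + 1) • F.e)) - 2 := by
    refine (energy_sweep_eat_last_le (h := h) hK hL hF.perp.neg_right hs (by omega)
      hseg hne hl hr).trans ?_
    rw [hb]
    gcongr with i hi
    rw [hb]
    linarith [dis_nonneg s (σ (F.o + i • F.e - -F.f))]
  rw [hsum] at hlast hpart
  have hd := dis_nonneg (F.base σ F.m) (σ (F.o + (F.m + 1) • F.e))
  have := hσ.energy_le (sweep σ F.o F.e (-F.f) (F.m + 1)) (reach_sweep fun k hk => by
    rcases Nat.lt_succ_iff_lt_or_eq.1 hk with hk | rfl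
    · linarith [hpart (k + 1) (by omega)]
    · linarith)
  linarith

end Frame

end Potts

/-! ### Impossibility of blocks; extremal configurations are constant -/

namespace Potts

theorem Perp.zsmul_eq_zero {K L : ℕ} [NeZero K] [NeZero L] {e f : Fin K × Fin L}
    (hef : Perp e f) {i j : ℤ} (hij : i • e + j • f = 0) : j • f = 0 := by
  rcases hef with ⟨rfl | rfl, rfl | rfl⟩ | ⟨rfl | rfl, rfl | rfl⟩ <;>
    simp_all [Prod.ext_iff]

namespace Frame

variable {K L q : ℕ} [NeZero K] [NeZero L] {h : ℝ} {s : Spin q} {σ : Config K L q}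

/-- A phase of spin different from `1` along the base consumes the whole block. -/
theorem IsBlock.exists_energy_lt (hK : 3 ≤ K) (hL : 3 ≤ L) (hs : (s : ℕ) ≠ 1)
    {b : Spin q} (hb1 : (b : ℕ) ≠ 1) {F : Frame K L} (hF : IsBlock σ s F)
    (hb : ∀ i ≤ F.m, F.base σ i = b) :
    ∃ τ, Reach h (energy K L q h σ + 2) σ τ ∧ energy K L q h τ < energy K L q h σ := by
  obtain ⟨o, e, f, m, n⟩ := F
  obtain ⟨perp, width, height, cells, bottom, top, left, right⟩ := hF
  simp only [base] at *
  have hkey : ∀ {n : ℕ} {σ : Config K L q} {o : Fin K × Fin L},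
      (∀ i ≤ m, ∀ j ≤ n, σ (o + i • e + j • f) = s) → (∀ i ≤ m, σ (o + i • e - f) ≠ s) →
      (∀ j ≤ n, σ (o - e + j • f) ≠ s) → (∀ j ≤ n, σ (o + (m + 1) • e + j • f) ≠ s) →
      (∀ i ≤ m, σ (o - f + i • e) = b) →
      Reach h (energy K L q h σ + 2) σ (sweep σ o e (-f) (m + 1)) ∧
      energy K L q h (sweep σ o e (-f) (m + 1)) ≤ energy K L q h σ - dis s (σ (o + f)) := by
    intro n σ o cells bottom left right hb
    have hseg : ∀ i ≤ m, σ (o + i • e) = s := fun i hi => by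
      simpa using cells i hi 0 (by omega)
    have hne : ∀ i ≤ m, σ (o + i • e + -f) ≠ s := fun i hi => by
      rw [← sub_eq_add_neg]; exact bottom i hi
    have hl : σ (o - e) ≠ s := by simpa using left 0 (by omega)
    have hr : σ (o + (m + 1) • e) ≠ s := by simpa using right 0 (by omega)
    have hb' : ∀ i ≤ m, σ (o + i • e + -f) = b := fun i hi => by
      rw [← hb i hi]; congr 1; abel
    -- After the first flip each new `b` stands next to the previous `b`, so only the first flip can
    -- create a disagreement.
    have hsum : ∀ k ≤ m, ∑ i ∈ Finset.range (k + 1), (dis (σ (o + i • e + -f))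
        (sweepPrev σ o e (-f) i) + h * one (σ (o + i • e + -f)) - dis s (σ (o + i • e - -f)))
        ≤ 1 - dis s (σ (o + f)) := by
      intro k hk
      rw [Finset.sum_range_succ']
      have h1 : ∑ i ∈ Finset.range k, (dis (σ (o + (i + 1) • e + -f))
          (sweepPrev σ o e (-f) (i + 1)) + h * one (σ (o + (i + 1) • e + -f))
          - dis s (σ (o + (i + 1) • e - -f))) ≤ 0 := by
        refine Finset.sum_nonpos fun i hi => ?_
        have hi' := Finset.mem_range.1 hi
        rw [sweepPrev, hb' _ (by omega), hb' _ (by omega), dis_self, one_of_ne hb1]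
        linarith [dis_nonneg s (σ (o + (i + 1) • e - -f))]
      rw [hb' 0 (by omega), one_of_ne hb1]
      have h2 := dis_le_one b (sweepPrev σ o e (-f) 0)
      simp only [zero_nsmul, add_zero, sub_neg_eq_add] at *
      linarith
    have hd := dis_nonneg s (σ (o + f))
    have hlast := energy_sweep_eat_last_le (h := h) hK hL perp.neg_right hs width hseg hne hl hr
    have hd' := dis_le_one (σ (o + m • e + -f)) (σ (o + (m + 1) • e))
    have hlast' : energy K L q h (sweep σ o e (-f) (m + 1))
        ≤ energy K L q h σ - dis s (σ (o + f)) := by linarith [hsum m le_rfl]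
    refine ⟨reach_sweep fun k hk => ?_, hlast'⟩
    rcases Nat.lt_succ_iff_lt_or_eq.1 hk with hk | rfl
    · have := energy_sweep_eat_le (h := h) hK hL perp.neg_right hs (k := k + 1) (by omega)
        (fun i hi => hseg i (by omega)) (fun i hi => hne i (by omega)) hl
      linarith [hsum k (by omega)]
    · linarith
  induction n generalizing σ o with
  | zero =>
    obtain ⟨hr, hle⟩ := hkey cells bottom left right hb
    refine ⟨_, hr, ?_⟩
    -- Consuming a line never raises the energy; for the last line the spin beyond it is not `s`,
    -- which makes the descent strict.
    rw [dis_of_ne (Ne.symm (by simpa using top 0 (by omega)))] at hle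
    linarith
  | succ n ih =>
    obtain ⟨hr, hle⟩ := hkey cells bottom left right hb
    set τ := sweep σ o e (-f) (m + 1) with hτ
    have hle' : energy K L q h τ ≤ energy K L q h σ := by
      linarith [dis_nonneg s (σ (o + f))]
    -- The index `i` is an integer because the left side of the block is the column `-1`.
    have hout : ∀ i : ℤ, ∀ j : ℕ, 0 < j → j < addOrderOf f →
        τ (o + i • e + j • f) = σ (o + i • e + j • f) := by
      intro i j hj0 hj
      refine sweep_of_ne fun k hk heq => ?_
      have : (i - k) • e + (j : ℤ) • f = 0 := by
        rw [sub_smul, natCast_zsmul, natCast_zsmul]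
        have := sub_eq_zero.2 heq
        rw [← this]; abel
      have := perp.zsmul_eq_zero this
      rw [natCast_zsmul] at this
      exact absurd (Nat.le_of_dvd hj0 (addOrderOf_dvd_of_nsmul_eq_zero this)) (by omega)
    have hcell : ∀ i j : ℕ, j + 1 < addOrderOf f →
        τ (o + f + i • e + j • f) = σ (o + i • e + (j + 1) • f) := by
      intro i j hj
      rw [← natCast_zsmul e i, ← hout i (j + 1) (by omega) hj]
      congr 1; rw [succ_nsmul]; abel
    have hrow : ∀ i ≤ m, τ (o + f - f + i • e) = b := by
      intro i hi
      rw [add_sub_cancel_right, hτ, sweep_apply (by omega) (by omega), ← hb i hi]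
      congr 1; abel
    obtain ⟨τ', hr', hlt⟩ := ih (σ := τ) (o + f) hrow (by omega)
      (fun i hi j hj => by rw [hcell i j (by omega)]; exact cells i hi (j + 1) (by omega))
      (fun i hi => by
        have : o + f + i • e - f = o + f - f + i • e := by abel
        rw [this, hrow i hi, ← hb 0 (by omega)]
        have : o - f + 0 • e = o + 0 • e - f := by abel
        rw [this]; exact bottom 0 (by omega))
      (fun i hi => by rw [hcell i (n + 1) (by omega)]; exact top i hi)
      (fun j hj => by
        have e1 : o + f - e + j • f = o + (-1 : ℤ) • e + (j + 1) • f := by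
          rw [succ_nsmul, neg_one_zsmul]; abel
        rw [e1, hout (-1) (j + 1) (by omega) (by omega), neg_one_zsmul, ← sub_eq_add_neg]
        exact left (j + 1) (by omega))
      (fun j hj => by rw [hcell (m + 1) j (by omega)]; exact right (j + 1) (by omega))
    exact ⟨τ', hr.trans (Reach.mono hr' (by linarith)), by linarith⟩

end Frame

/-- Side `i` runs from spin `x i` to `y i`, between the corner spins `c i` and `c (i + 1)`.
Expansion compares its ends with the corners, consumption with the ends of the adjacent sides; if
the two comparisons can be matched, the same cost is both below 2 and at least 2. -/
theorem not_all_sides {q : ℕ} {x y c : ℕ → Spin q} {inner w : ℕ → ℝ} (hw : ∀ i, 0 ≤ w i)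
    (hexp : ∀ i, inner i + dis (c i) (x i) + dis (y i) (c (i + 1)) + w i < 2)
    (heat : ∀ i, 2 ≤ inner (i + 1) + dis (y i) (x (i + 1)) + dis (y (i + 1)) (x (i + 2))
      + w (i + 1))
    (hmono : ∀ i, inner i < 1 → ((x i : Spin q) : ℕ) = 1 ∧ y i = x i) : False := by
  have eq_of_lt : ∀ a b : Spin q, dis a b < 1 → a = b := fun a b hab => by
    by_contra hne; rw [dis_of_ne hne] at hab; exact lt_irrefl _ hab
  have hy : ∀ i, 1 ≤ inner i → y i = c (i + 1) := fun i hi => eq_of_lt _ _ (by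
    linarith [hexp i, hw i, dis_nonneg (c i) (x i)])
  have hx : ∀ i, 1 ≤ inner i → c i = x i := fun i hi => eq_of_lt _ _ (by
    linarith [hexp i, hw i, dis_nonneg (y i) (c (i + 1))])
  -- An unchanging side has spin `1`. An adjacent side either is also all `1`, giving no
  -- disagreement, or has a change and so agrees with the common corner. Consumption thus costs no
  -- more than expansion.
  have hbig : ∀ i, 1 ≤ inner (i + 1) := by
    intro i
    by_contra! hlt
    obtain ⟨h1, h2⟩ := hmono _ hlt
    have hl : dis (y i) (x (i + 1)) ≤ dis (c (i + 1)) (x (i + 1)) := by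
      rcases lt_or_ge (inner i) 1 with hi | hi
      · obtain ⟨h3, h4⟩ := hmono _ hi
        have : y i = x (i + 1) := by rw [h4]; exact Subtype.ext (h3.trans h1.symm)
        rw [this, dis_self]; exact dis_nonneg _ _
      · rw [hy i hi]
    have hr : dis (y (i + 1)) (x (i + 2)) ≤ dis (y (i + 1)) (c (i + 2)) := by
      rcases lt_or_ge (inner (i + 2)) 1 with hi | hi
      · obtain ⟨h3, h4⟩ := hmono _ hi
        have : y (i + 1) = x (i + 2) := by rw [h2]; exact Subtype.ext (h1.trans h3.symm)
        rw [this, dis_self]; exact dis_nonneg _ _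
      · rw [hx (i + 2) hi]
    linarith [hexp (i + 1), heat i]
  -- Now every side involved has a change, so its ends equal its corners and the two costs of side 2
  -- coincide.
  have h1 := heat 1
  have h2 := hexp 2
  rw [hy 1 (hbig 0), ← hx 3 (hbig 2)] at h1
  linarith

section Extremal

variable {K L q : ℕ} [NeZero K] [NeZero L] {h : ℝ} {s : Spin q} {σ : Config K L q}

theorem Extremal.not_isBlock (hK : 3 ≤ K) (hL : 3 ≤ L) (h0 : 0 ≤ h) (hs : (s : ℕ) ≠ 1)
    (hσ : Extremal h s σ) (F : Frame K L) : ¬ F.IsBlock σ s := by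
  intro hF
  set R : ℕ → Frame K L := fun i => Frame.rotate^[i] F with hR
  have hsucc : ∀ i, R (i + 1) = (R i).rotate := fun i => Function.iterate_succ_apply' _ _ _
  have hblock : ∀ i, (R i).IsBlock σ s := by
    intro i
    induction i with
    | zero => exact hF
    | succ i ih => rw [hsucc]; exact ih.rotate
  refine not_all_sides (x := fun i => (R i).base σ 0) (y := fun i => (R i).base σ (R i).m)
    (c := fun i => (R i).corner σ) (inner := fun i => (R i).changes σ)
    (w := fun i => h * (R i).ones σ) (fun i => mul_nonneg h0 (Frame.ones_nonneg _ _))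
    (fun i => ?_) (fun i => ?_) (fun i hi => ?_)
  · simp only [hsucc]
    exact (hblock i).expand_lt hK hL h0 hs hσ
  · have := (hblock (i + 1)).le_eat hK hL h0 hs hσ
    rw [hsucc (i + 1), ← Frame.rotate_behind, ← hsucc]
    exact this
  · have hall : ∀ j ≤ (R i).m, (R i).base σ j = (R i).base σ 0 := fun j hj =>
      Frame.base_eq_of_changes_lt hi hj
    refine ⟨?_, hall _ le_rfl⟩
    by_contra hb1
    obtain ⟨τ, hr, hlt⟩ := (hblock i).exists_energy_lt (h := h) hK hL hs hb1 hall
    exact absurd (hσ.energy_le τ hr) (not_le.2 hlt)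

/-- An extremal configuration for a spin that it contains is constant. -/
theorem Extremal.eq_const (hK : 3 ≤ K) (hL : 3 ≤ L) (h0 : 0 ≤ h) (hs : (s : ℕ) ≠ 1)
    (hσ : Extremal h s σ) {v₀ : Fin K × Fin L} (hv₀ : σ v₀ = s) (v : Fin K × Fin L) :
    σ v = s := by
  classical
  set X := unitX K L with hX
  set Y := unitY K L with hY
  have hXY : Perp X Y := perp_unitX_unitY
  let P : ℕ × ℕ → Prop := fun d => ∃ o, ∀ i ≤ d.1, ∀ j ≤ d.2, σ (o + i • X + j • Y) = s
  let T := (Finset.range K ×ˢ Finset.range L).filter P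
  have hT : T.Nonempty := by
    refine ⟨(0, 0), Finset.mem_filter.2 ⟨by simp; omega, v₀, fun i hi j hj => ?_⟩⟩
    obtain rfl : i = 0 := by simpa using hi
    obtain rfl : j = 0 := by simpa using hj
    simpa using hv₀
  -- With `m + n` maximal, an `s` beside the rectangle would by `Extremal.side_eq` fill that whole
  -- side and give a larger rectangle.
  obtain ⟨⟨m, n⟩, hmem, hmax⟩ := Finset.exists_max_image T (fun d => d.1 + d.2) hT
  simp only [T, P, Finset.mem_filter, Finset.mem_product, Finset.mem_range] at hmem hmax
  obtain ⟨⟨hm, hn⟩, o, ho⟩ := hmem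
  have hconst : (∀ i j : ℕ, σ (o + i • X + j • Y) = s) → σ v = s := by
    intro hall
    obtain ⟨i, j, rfl⟩ := exists_eq_add_nsmul o v
    exact hall i j
  by_cases hm' : m + 1 = K
  · refine hconst (hσ.eq_const_of_line hK hL h0 hs hXY fun j => ?_)
    have hmod := mod_addOrderOf_nsmul X j
    rw [addOrderOf_unitX] at hmod
    rw [← hmod]
    simpa using ho (j % K) (by have := Nat.mod_lt j (NeZero.pos K); omega) 0 (by omega)
  by_cases hn' : n + 1 = L
  · refine hconst fun i j => ?_
    rw [add_right_comm]
    refine hσ.eq_const_of_line hK hL h0 hs hXY.symm (fun j => ?_) j i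
    have hmod := mod_addOrderOf_nsmul Y j
    rw [addOrderOf_unitY] at hmod
    rw [← hmod]
    simpa using ho 0 (by omega) (j % L) (by have := Nat.mod_lt j (NeZero.pos L); omega)
  exfalso
  have noX : ∀ o', ¬ ∀ i ≤ m + 1, ∀ j ≤ n, σ (o' + i • X + j • Y) = s := fun o' ho' => by
    have := hmax (m + 1, n) ⟨⟨by simp; omega, hn⟩, o', ho'⟩
    simp at this
  have noY : ∀ o', ¬ ∀ i ≤ m, ∀ j ≤ n + 1, σ (o' + i • X + j • Y) = s := fun o' ho' => by
    have := hmax (m, n + 1) ⟨⟨hm, by simp; omega⟩, o', ho'⟩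
    simp at this
  refine hσ.not_isBlock hK hL h0 hs ⟨o, X, Y, m, n⟩ ⟨hXY, ?_, ?_, ho, ?_, ?_, ?_, ?_⟩
  · rw [hX, addOrderOf_unitX]; simp only; omega
  · rw [hY, addOrderOf_unitY]; simp only; omega
  · intro i hi his
    have := hσ.side_eq hK hL h0 hs hXY.neg_right (o := o) hi
      (fun j hj => by simpa using ho j hj 0 (by omega)) (by rw [← sub_eq_add_neg]; exact his)
    refine noY (o - Y) fun i hi j hj => ?_
    cases j with
    | zero => rw [← this i hi]; congr 1; rw [zero_nsmul]; abel
    | succ j => rw [← ho i hi j (by omega)]; congr 1; rw [succ_nsmul]; abel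
  · intro i hi his
    simp only at hi his
    have e1 : ∀ i : ℕ, o + n • Y + i • X + Y = o + i • X + (n + 1) • Y := fun i => by
      rw [succ_nsmul]; abel
    have := hσ.side_eq hK hL h0 hs hXY (o := o + n • Y) hi
      (fun j hj => by rw [add_right_comm]; exact ho j hj n le_rfl) (by rw [e1]; exact his)
    refine noY o fun i hi j hj => ?_
    rcases Nat.le_succ_iff.1 hj with hj | rfl
    · exact ho i hi j hj
    · rw [← this i hi, e1]
  · intro j hj hjs
    simp only at hj hjs
    have e1 : ∀ j : ℕ, o + j • Y + -X = o - X + j • Y := fun j => by abel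
    have := hσ.side_eq hK hL h0 hs hXY.symm.neg_right (o := o) hj
      (fun j hj => by simpa using ho 0 (by omega) j hj) (by rw [e1]; exact hjs)
    refine noX (o - X) fun i hi j hj => ?_
    cases i with
    | zero => rw [← this j hj, e1]; simp
    | succ i => rw [← ho i (by omega) j hj]; congr 1; rw [succ_nsmul]; abel
  · intro j hj hjs
    simp only at hj hjs
    have e1 : ∀ j : ℕ, o + m • X + j • Y + X = o + (m + 1) • X + j • Y := fun j => by
      rw [succ_nsmul]; abel
    have := hσ.side_eq hK hL h0 hs hXY.symm (o := o + m • X) hj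
      (fun j hj => ho m le_rfl j hj) (by rw [e1]; exact hjs)
    refine noX o fun i hi j hj => ?_
    rcases Nat.le_succ_iff.1 hi with hi | rfl
    · exact ho i hi j hj
    · rw [← this j hj, e1]

end Extremal

end Potts

/-! ### Communication heights and barriers in an abstract landscape -/

namespace Landscape

variable {X : Type*} {H : X → ℝ} {Q : X → X → ℝ}

theorem Path.height_le {σ σ' : X} {ω : Path Q σ σ'} {C : ℝ} (hω : ∀ i, H (ω.state i) ≤ C) :
    ω.height H ≤ C :=
  Finset.sup'_le _ _ fun i _ => hω i

theorem Path.le_height {σ σ' : X} (ω : Path Q σ σ') (i : Fin (ω.length + 1)) :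
    H (ω.state i) ≤ ω.height H :=
  Finset.le_sup' (fun i => H (ω.state i)) (Finset.mem_univ i)

theorem exists_path_height_le {σ η : X} {C : ℝ} (hσ : H σ ≤ C)
    (hr : Relation.ReflTransGen (fun a b => H b ≤ C ∧ 0 < Q a b) σ η) :
    ∃ ω : Path Q σ η, ∀ i, H (ω.state i) ≤ C := by
  induction hr with
  | refl => exact ⟨⟨0, fun _ => σ, rfl, rfl, fun i => i.elim0⟩, fun _ => hσ⟩
  | @tail b c _ hbc ih =>
    obtain ⟨ω, hω⟩ := ih
    refine ⟨⟨ω.length + 1, Fin.snoc (α := fun _ => X) ω.state c, ?_, ?_, fun i => ?_⟩, fun i => ?_⟩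
    · have : (0 : Fin (ω.length + 1 + 1)) = Fin.castSucc 0 := rfl
      rw [this, Fin.snoc_castSucc, ω.source]
    · rw [Fin.snoc_last]
    · induction i using Fin.lastCases with
      | last =>
        rw [Fin.succ_last, Fin.snoc_last, Fin.snoc_castSucc, ω.target]
        exact hbc.2
      | cast i =>
        rw [Fin.snoc_castSucc, Fin.succ_castSucc, Fin.snoc_castSucc]
        exact ω.step i
    · induction i using Fin.lastCases with
      | last => simpa using hbc.1
      | cast i => simpa using hω i

theorem commHeightSet_le {σ η : X} {A : Set X} (hη : η ∈ A) {C : ℝ} (ω : Path Q σ η)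
    (hω : ∀ i, H (ω.state i) ≤ C) : commHeightSet H Q {σ} A ≤ (C : EReal) := by
  refine (iInf₂_le σ (Set.mem_singleton σ)).trans ((iInf₂_le η hη).trans ((iInf_le _ ω).trans ?_))
  exact EReal.coe_le_coe_iff.2 (Path.height_le hω)

theorem le_commHeightSet {σ : X} {A : Set X} {C : ℝ}
    (hC : ∀ η ∈ A, ∀ ω : Path Q σ η, ∃ i, C ≤ H (ω.state i)) :
    (C : EReal) ≤ commHeightSet H Q {σ} A := by
  refine le_iInf₂ fun σ' hσ' => le_iInf₂ fun η hη => le_iInf fun ω => ?_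
  obtain rfl : σ' = σ := hσ'
  obtain ⟨i, hi⟩ := hC η hη ω
  exact EReal.coe_le_coe_iff.2 (hi.trans (ω.le_height i))

theorem commHeightSet_anti {A B B' : Set X} (hB : B ⊆ B') :
    commHeightSet H Q A B' ≤ commHeightSet H Q A B :=
  iInf₂_mono fun _ _ => biInf_mono hB

theorem barrier_le {σ : X} {A : Set X} {c : ℝ}
    (hc : commHeightSet H Q {σ} A ≤ ((H σ + c : ℝ) : EReal)) : barrier H Q σ A ≤ (c : EReal) := by
  refine (EReal.sub_le_sub hc le_rfl).trans ?_
  rw [← EReal.coe_sub, add_sub_cancel_left]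

theorem barrier_eq {σ : X} {A : Set X} {c : ℝ}
    (hc : commHeightSet H Q {σ} A = ((H σ + c : ℝ) : EReal)) : barrier H Q σ A = (c : EReal) := by
  rw [barrier, hc, ← EReal.coe_sub, add_sub_cancel_left]

theorem stabilityLevel_eq_top {σ : X} (hσ : σ ∈ stableStates H) : stabilityLevel H Q σ = ⊤ := by
  have : lowerStates H σ = ∅ := by
    ext η
    simpa [lowerStates] using hσ.2 η (Set.mem_univ η)
  rw [stabilityLevel, barrier, this]
  simp [commHeightSet]

end Landscape

/-! ### Stability levels of configurations with a spin different from `1` -/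

namespace Potts

theorem connectivity_update_pos {K L q : ℕ} (hq : 0 < q) [NeZero K] [NeZero L]
    {σ : Config K L q} {v : Fin K × Fin L} {c : Spin q} (hc : σ v ≠ c) :
    0 < connectivity K L q σ (Function.update σ v c) := by
  have : (Finset.univ.filter fun u => σ u ≠ Function.update σ v c u) = {v} := by
    ext u
    simp only [Finset.mem_filter, Finset.mem_univ, true_and, Finset.mem_singleton]
    constructor
    · intro hu
      by_contra huv
      exact hu (Function.update_of_ne huv _ _).symm
    · rintro rfl
      rwa [Function.update_self]
  rw [connectivity, if_pos (by rw [this, Finset.card_singleton])]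
  have hcard : 0 < Fintype.card (Fin K × Fin L) := Fintype.card_pos
  positivity

theorem Reach.exists_path {K L q : ℕ} (hq : 0 < q) [NeZero K] [NeZero L] {h C : ℝ}
    {σ η : Config K L q} (hr : Reach h C σ η) (hσ : energy K L q h σ ≤ C) :
    ∃ ω : Landscape.Path (connectivity K L q) σ η, ∀ i, energy K L q h (ω.state i) ≤ C := by
  refine Landscape.exists_path_height_le hσ ?_
  induction hr with
  | refl => exact .refl
  | @tail b c _ hbc ih =>
    obtain ⟨hc, v, a, rfl⟩ := hbc
    by_cases hva : b v = a
    -- `Reach` admits updates that change nothing; these are not steps of a path and are dropped.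
    · rwa [← hva, Function.update_eq_self]
    · exact ih.tail ⟨hc, connectivity_update_pos hq hva⟩

theorem exists_ne_one_of_energy_lt {K L q : ℕ} {h : ℝ} (hq : 2 < q)
    {σ : Config K L q}
    (hlt : energy K L q h σ < energy K L q h (allOne K L q hq)) : ∃ v, (σ v : ℕ) ≠ 1 := by
  by_contra! hall
  have : σ = allOne K L q hq := funext fun v => Subtype.ext (hall v)
  rw [this] at hlt
  exact lt_irrefl _ hlt

section Stability

variable {K L q : ℕ} [NeZero K] [NeZero L] {h : ℝ}

theorem energy_const_le (hK : 3 ≤ K) (hL : 3 ≤ L) (h0 : 0 ≤ h) {s : Spin q} (hs : (s : ℕ) ≠ 1)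
    {η : Config K L q} (hη : ∀ v, η v = s) (τ : Config K L q) :
    energy K L q h η ≤ energy K L q h τ := by
  rw [energy_eq hK hL, energy_eq hK hL]
  simp only [hη, agr_self, one_of_ne hs, Finset.sum_const_zero, mul_zero, add_zero]
  have h1 : ∑ v, (agr (τ v) (τ (v + unitX K L)) + agr (τ v) (τ (v + unitY K L)))
      ≤ ∑ _v : Fin K × Fin L, ((1 : ℝ) + 1) :=
    Finset.sum_le_sum fun v _ => add_le_add (agr_le_one _ _) (agr_le_one _ _)
  have h2 : 0 ≤ h * ∑ v, one (τ v) :=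
    mul_nonneg h0 (Finset.sum_nonneg fun _ _ => one_nonneg _)
  linarith

/-- A state that is not stable and has a spin different from `1` reaches a state of lower energy
within the barrier `2`. -/
theorem exists_reach_energy_lt (hK : 3 ≤ K) (hL : 3 ≤ L) (h0 : 0 ≤ h) {σ : Config K L q}
    (hσ : σ ∉ Landscape.stableStates (energy K L q h)) {v₀ : Fin K × Fin L}
    (hv₀ : (σ v₀ : ℕ) ≠ 1) :
    ∃ τ, Reach h (energy K L q h σ + 2) σ τ ∧ energy K L q h τ < energy K L q h σ := by
  classical
  by_contra! hno
  let S : Finset (Config K L q) := Finset.univ.filter fun τ =>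
    Reach h (energy K L q h σ + 2) σ τ ∧ energy K L q h τ ≤ energy K L q h σ
  obtain ⟨η, hηS, hmax⟩ := Finset.exists_max_image S (spinCount (σ v₀))
    ⟨σ, Finset.mem_filter.2 ⟨Finset.mem_univ _, Relation.ReflTransGen.refl, le_rfl⟩⟩
  obtain ⟨-, hr, hle⟩ := Finset.mem_filter.1 hηS
  have heq : energy K L q h η = energy K L q h σ := le_antisymm hle (hno η hr)
  -- Since `η` has the energy of `σ`, the barrier 2 above either is the same level, so everything
  -- reachable from `η` is reachable from `σ`.
  have hext : Extremal h (σ v₀) η := by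
    refine ⟨fun τ hτ => ?_, fun τ hτ hτle => ?_⟩
    · rw [heq] at hτ ⊢
      exact hno τ (hr.trans hτ)
    · rw [heq] at hτ hτle
      exact hmax τ (Finset.mem_filter.2 ⟨Finset.mem_univ _, hr.trans hτ, hτle⟩)
  have hcount : 0 < spinCount (σ v₀) η :=
    lt_of_lt_of_le (Finset.card_pos.2 ⟨v₀, by simp⟩)
      (hmax σ (Finset.mem_filter.2 ⟨Finset.mem_univ _, Relation.ReflTransGen.refl, le_rfl⟩))
  obtain ⟨w, hw⟩ := Finset.card_pos.1 hcount
  have hw' : η w = σ v₀ := by simpa using hw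
  have hconst := hext.eq_const hK hL h0 hv₀ hw'
  refine hσ ⟨Set.mem_univ _, fun τ _ => ?_⟩
  rw [← heq]
  exact energy_const_le hK hL h0 hv₀ hconst τ

theorem stabilityLevel_le_two (hK : 3 ≤ K) (hL : 3 ≤ L) (h0 : 0 ≤ h) (hq : 0 < q)
    {σ : Config K L q} (hσ : σ ∉ Landscape.stableStates (energy K L q h))
    {v₀ : Fin K × Fin L} (hv₀ : (σ v₀ : ℕ) ≠ 1) :
    Landscape.stabilityLevel (energy K L q h) (connectivity K L q) σ ≤ ((2 : ℝ) : EReal) := by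
  obtain ⟨τ, hr, hlt⟩ := exists_reach_energy_lt hK hL h0 hσ hv₀
  obtain ⟨ω, hω⟩ := hr.exists_path hq (by linarith)
  exact Landscape.barrier_le (Landscape.commHeightSet_le (η := τ) (show τ ∈ _ from hlt) ω hω)

/-- A state of energy lower than that of `allOne` reaches a stable state within the barrier `2`
above `allOne`. -/
theorem exists_reach_stable (hK : 3 ≤ K) (hL : 3 ≤ L) (h0 : 0 ≤ h) (hq : 2 < q)
    {σ : Config K L q} (hlt : energy K L q h σ < energy K L q h (allOne K L q hq)) :
    ∃ η ∈ Landscape.stableStates (energy K L q h),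
      Reach h (energy K L q h (allOne K L q hq) + 2) σ η := by
  classical
  let S : Finset (Config K L q) := Finset.univ.filter fun τ =>
    Reach h (energy K L q h (allOne K L q hq) + 2) σ τ ∧ energy K L q h τ ≤ energy K L q h σ
  obtain ⟨η, hηS, hmin⟩ := Finset.exists_min_image S (energy K L q h)
    ⟨σ, Finset.mem_filter.2 ⟨Finset.mem_univ _, Relation.ReflTransGen.refl, le_rfl⟩⟩
  obtain ⟨-, hr, hle⟩ := Finset.mem_filter.1 hηS
  refine ⟨η, ?_, hr⟩
  by_contra hη
  have hη1 : energy K L q h η < energy K L q h (allOne K L q hq) := by linarith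
  obtain ⟨v₀, hv₀⟩ := exists_ne_one_of_energy_lt hq hη1
  obtain ⟨τ, hτ, hτlt⟩ := exists_reach_energy_lt hK hL h0 hη hv₀
  have := hmin τ (Finset.mem_filter.2
    ⟨Finset.mem_univ _, hr.trans (hτ.mono (by linarith)), by linarith⟩)
  linarith

end Stability

end Potts

namespace Potts

/-! ### Growth of a droplet -/

open Classical in
/-- The rectangle of the vertices `i e + j f`, `i < m`, `j < n`, of spin `s` in a sea of spins
`a`. -/
noncomputable def droplet {K L q : ℕ} [NeZero K] [NeZero L] (a s : Spin q) (e f : Fin K × Fin L)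
    (m n : ℕ) : Config K L q :=
  fun v => if ∃ i < m, ∃ j < n, v = i • e + j • f then s else a

section Droplet

variable {K L q : ℕ} [NeZero K] [NeZero L] {h : ℝ} {a s : Spin q} {e f : Fin K × Fin L} {m n : ℕ}

theorem droplet_comm : droplet a s e f m n = droplet a s f e n m := by
  funext v
  unfold droplet
  congr 1
  refine propext ⟨?_, ?_⟩
  · rintro ⟨i, hi, j, hj, rfl⟩; exact ⟨j, hj, i, hi, add_comm _ _⟩
  · rintro ⟨i, hi, j, hj, rfl⟩; exact ⟨j, hj, i, hi, add_comm _ _⟩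

theorem droplet_side {i : ℕ} (hi : i < m) (hn : 1 ≤ n) :
    droplet a s e f m n (n • f + i • e + -f) = s := by
  refine if_pos ⟨i, hi, n - 1, by omega, ?_⟩
  obtain ⟨n, rfl⟩ : ∃ n', n = n' + 1 := ⟨n - 1, by omega⟩
  rw [Nat.add_sub_cancel, succ_nsmul]; abel

theorem droplet_line (hef : Perp e f) {i : ℕ} (hn : n < addOrderOf f) :
    droplet a s e f m n (n • f + i • e) = a := by
  refine if_neg ?_
  rintro ⟨i', -, j', hj', heq⟩
  have h1 : ((i : ℤ) - i') • e + ((n - j' : ℕ) : ℤ) • f = 0 := by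
    rw [Nat.cast_sub hj'.le, sub_smul, sub_smul, natCast_zsmul, natCast_zsmul, natCast_zsmul,
      natCast_zsmul]
    have := sub_eq_zero.2 heq
    rw [← this]; abel
  have h2 := hef.zsmul_eq_zero h1
  rw [natCast_zsmul] at h2
  exact absurd (Nat.le_of_dvd (by omega) (addOrderOf_dvd_of_nsmul_eq_zero h2)) (by omega)

theorem sweep_droplet (hm : m ≤ addOrderOf e) (hn : 1 ≤ n) :
    sweep (droplet a s e f m n) (n • f) e (-f) m = droplet a s e f m (n + 1) := by
  funext v
  by_cases hv : ∃ i < m, v = n • f + i • e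
  · obtain ⟨i, hi, rfl⟩ := hv
    rw [sweep_apply hi hm, droplet_side hi hn]
    exact (if_pos ⟨i, hi, n, by omega, add_comm _ _⟩).symm
  · push Not at hv
    rw [sweep_of_ne hv]
    unfold droplet
    congr 1
    refine propext ⟨?_, ?_⟩
    · rintro ⟨i, hi, j, hj, rfl⟩
      exact ⟨i, hi, j, by omega, rfl⟩
    · rintro ⟨i, hi, j, hj, rfl⟩
      rcases Nat.lt_succ_iff_lt_or_eq.1 hj with hj | rfl
      · exact ⟨i, hi, j, hj, rfl⟩
      · exact absurd (add_comm _ _) (hv i hi)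

/-- The first vertex of the new line raises the energy by at most `2 - h`; each later one lowers it
by at least `h`. -/
theorem reach_droplet_succ (hK : 3 ≤ K) (hL : 3 ≤ L) (h0 : 0 ≤ h) (hef : Perp e f)
    (ha : (a : ℕ) = 1) (hs : (s : ℕ) ≠ 1) (hm1 : 1 ≤ m) (hm : m < addOrderOf e) (hn1 : 1 ≤ n)
    (hn : n < addOrderOf f) {C : ℝ}
    (hC : energy K L q h (droplet a s e f m n) + 2 - h ≤ C) :
    Reach h C (droplet a s e f m n) (droplet a s e f m (n + 1)) ∧
    energy K L q h (droplet a s e f m (n + 1))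
      ≤ energy K L q h (droplet a s e f m n) + 2 - h * m := by
  have has : a ≠ s := fun has => hs (has ▸ ha)
  have hen : ∀ k < m, energy K L q h (sweep (droplet a s e f m n) (n • f) e (-f) (k + 1))
      ≤ energy K L q h (droplet a s e f m n) + 2 - h * (k + 1 : ℕ) := by
    intro k hk
    have h1 := energy_sweep_expand_le (h := h) (σ := droplet a s e f m n) (x := n • f) hK hL
      hef.neg_right hs (k := k) (by omega) (fun i hi => droplet_side (by omega) hn1)
      (fun i hi => by rw [droplet_line hef hn]; exact has)
    have h2 : h * (k + 1 : ℕ) ≤ ∑ i ∈ Finset.range (k + 1),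
        (dis (droplet a s e f m n (n • f + i • e)) (droplet a s e f m n (n • f + (i + 1) • e))
          + h * one (droplet a s e f m n (n • f + i • e))) := by
      have : h * (k + 1 : ℕ) = ∑ i ∈ Finset.range (k + 1), h := by
        rw [Finset.sum_const, Finset.card_range, nsmul_eq_mul, mul_comm]
      rw [this]
      refine Finset.sum_le_sum fun i _ => ?_
      rw [droplet_line hef hn, one_of_eq ha, mul_one]
      linarith [dis_nonneg a (droplet a s e f m n (n • f + (i + 1) • e))]
    linarith [dis_nonneg (droplet a s e f m n (n • f - e)) (droplet a s e f m n (n • f))]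
  rw [← sweep_droplet hm.le hn1]
  refine ⟨reach_sweep fun k hk => (hen k hk).trans (le_trans ?_ hC), ?_⟩
  · push_cast
    nlinarith [mul_nonneg h0 (Nat.cast_nonneg (α := ℝ) k)]
  · obtain ⟨m, rfl⟩ : ∃ m', m = m' + 1 := ⟨m - 1, by omega⟩
    exact hen m (by omega)

/-- Growth of a square droplet from the configuration of constant spin `1`. -/
theorem reach_droplet_square (hK : 3 ≤ K) (hL : 3 ≤ L) (h0 : 0 ≤ h) (hef : Perp e f)
    (ha : (a : ℕ) = 1) (hs : (s : ℕ) ≠ 1) {C : ℝ} {N : ℕ} (hN : N < addOrderOf e)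
    (hN' : N < addOrderOf f)
    (hC1 : ∀ b : ℕ, 4 * (b : ℝ) + 2 - h * (b ^ 2 + 1)
      ≤ C - energy K L q h (fun _ => a))
    (hC2 : ∀ b : ℕ, 4 * (b : ℝ) + 4 - h * (b ^ 2 + b + 1)
      ≤ C - energy K L q h (fun _ => a)) {b : ℕ} (hb : b + 1 ≤ N) :
    Reach h C (fun _ => a) (droplet a s e f (b + 1) (b + 1)) ∧
    energy K L q h (droplet a s e f (b + 1) (b + 1))
      ≤ energy K L q h (fun _ => a) + 4 * (b + 1) - h * (b + 1) ^ 2 := by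
  have has : a ≠ s := fun has => hs (has ▸ ha)
  induction b with
  | zero =>
    have h1 : droplet a s e f (0 + 1) (0 + 1) = Function.update (fun _ => a) 0 s := by
      funext v
      unfold droplet
      by_cases hv : v = 0
      · subst hv
        rw [Function.update_self]
        exact if_pos ⟨0, by simp, 0, by simp, by simp⟩
      · rw [Function.update_of_ne hv]
        refine if_neg ?_
        rintro ⟨i, hi, j, hj, rfl⟩
        obtain rfl : i = 0 := by omega
        obtain rfl : j = 0 := by omega
        simp at hv
    have h2 := energy_update (h := h) hK hL hef (fun _ => a) 0 s
    simp only [agr_self, agr_of_ne has.symm, one_of_ne hs, one_of_eq ha] at h2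
    have h3 := hC2 0
    rw [h1]
    push_cast at h3 ⊢
    exact ⟨.single ⟨by linarith, _, _, rfl⟩, by linarith⟩
  | succ b ih =>
    obtain ⟨hr, hE⟩ := ih (by omega)
    -- `c1` bounds the height of the protuberance on the square, `c2` that on the quasi-square to
    -- which one line has been added.
    have c1 := hC1 (b + 1)
    have c2 := hC2 (b + 1)
    push_cast at c1 c2 ⊢
    obtain ⟨hr1, hE1⟩ := reach_droplet_succ (C := C) hK hL h0 hef ha hs (m := b + 1) (n := b + 1)
      (by omega) (by omega) (by omega) (by omega) (by linarith)
    rw [droplet_comm (n := b + 1 + 1)] at hr1 hE1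
    push_cast at hE1
    obtain ⟨hr2, hE2⟩ := reach_droplet_succ (C := C) hK hL h0 hef.symm ha hs (m := b + 1 + 1)
      (n := b + 1) (by omega) (by omega) (by omega) (by omega) (by linarith)
    rw [droplet_comm (n := b + 1 + 1)] at hr2 hE2
    push_cast at hE2
    exact ⟨(hr.trans hr1).trans hr2, by linarith⟩

end Droplet

end Potts

namespace Potts

/-! ### The isoperimetric inequality on the torus -/

theorem exists_not_succ_of_exists {K : ℕ} [NeZero K] {P : Fin K → Prop} (h1 : ∃ x, P x)
    (h2 : ∃ x, ¬ P x) : ∃ x, P x ∧ ¬ P (x + 1) := by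
  by_contra! hall
  obtain ⟨x, hx⟩ := h1
  obtain ⟨y, hy⟩ := h2
  have : ∀ i : ℕ, P (x + i • 1) := by
    intro i
    induction i with
    | zero => simpa using hx
    | succ i ih => rw [succ_nsmul, ← add_assoc]; exact hall _ ih
  have h3 := this (y - x).val
  have h4 : ((y - x).val • (1 : Fin K)) = y - x := Fin.ext (by
    rw [nsmul_one_val, Nat.mod_eq_of_lt (Fin.is_lt _)])
  rw [h4, add_sub_cancel] at h3
  exact hy h3

/-- Around a cycle, a set that is neither empty nor everything is both left and entered. -/
theorem two_le_sum_dis {K q : ℕ} [NeZero K] {g : Fin K → Spin q} (h1 : ∃ x, (g x : ℕ) ≠ 1)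
    (h2 : ∃ x, ¬ (g x : ℕ) ≠ 1) : 2 ≤ ∑ x, dis (g x) (g (x + 1)) := by
  obtain ⟨x, hx, hx'⟩ := exists_not_succ_of_exists h1 h2
  obtain ⟨y, hy, hy'⟩ := exists_not_succ_of_exists (P := fun x => ¬ (g x : ℕ) ≠ 1) h2
    (by simpa using h1)
  have hxy : x ≠ y := fun hxy => hy (hxy ▸ hx)
  have hdx : dis (g x) (g (x + 1)) = 1 := dis_of_ne fun heq => hx' (heq ▸ hx)
  have hdy : dis (g y) (g (y + 1)) = 1 := dis_of_ne fun heq => hy' (heq ▸ hy)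
  calc (2 : ℝ) = ∑ z ∈ {x, y}, dis (g z) (g (z + 1)) := by
        rw [Finset.sum_pair hxy, hdx, hdy]; norm_num
    _ ≤ _ := Finset.sum_le_sum_of_subset_of_nonneg (Finset.subset_univ _)
        fun _ _ _ => dis_nonneg _ _

open Classical in
/-- The number of `b` for which `P b` holds somewhere but not everywhere. -/
noncomputable def mixedCount {α β : Type*} [Fintype β] (P : β → α → Prop) : ℕ :=
  (Finset.univ.filter fun b => (∃ a, P b a) ∧ ∃ a, ¬ P b a).card

theorem mixedCount_nsmul_le {α β : Type*} [Fintype β] {P : β → α → Prop} {w : β → ℝ} {c : ℝ}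
    (hw : ∀ b, 0 ≤ w b) (hc : ∀ b, (∃ a, P b a) → (∃ a, ¬ P b a) → c ≤ w b) :
    mixedCount P • c ≤ ∑ b, w b := by
  classical
  rw [mixedCount, ← Finset.sum_const]
  refine (Finset.sum_le_sum fun b hb => ?_).trans (Finset.sum_le_sum_of_subset_of_nonneg
    (Finset.filter_subset _ _) fun b _ _ => hw b)
  obtain ⟨h1, h2⟩ := (Finset.mem_filter.1 hb).2
  exact hc b h1 h2

theorem two_mul_mixedCount_le {K q : ℕ} {β : Type*} [Fintype β] [NeZero K]
    (g : β → Fin K → Spin q) :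
    2 * (mixedCount fun b x => (g b x : ℕ) ≠ 1 : ℝ) ≤ ∑ b, ∑ x, dis (g b x) (g b (x + 1)) := by
  rw [mul_comm, ← nsmul_eq_mul]
  exact mixedCount_nsmul_le (fun b => Finset.sum_nonneg fun _ _ => dis_nonneg _ _)
    fun b h1 h2 => two_le_sum_dis h1 h2

/-- A set of at most `ℓ ^ 2` vertices that contains a full line meets many transversal lines. -/
theorem two_mul_le_mixedCount {α β : Type*} [Fintype α] [Fintype β] {P : β → α → Prop} {ℓ : ℕ}
    (hα : 3 * ℓ ≤ Fintype.card α) (hβ : 3 * ℓ ≤ Fintype.card β) {S : Finset (β × α)}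
    (hS : ∀ b a, P b a → (b, a) ∈ S) (hcard : S.card ≤ ℓ ^ 2) {a₀ : α} (ha₀ : ∀ b, P b a₀) :
    2 * ℓ ≤ mixedCount P := by
  classical
  rcases Nat.eq_zero_or_pos ℓ with rfl | hℓ
  · simp
  let T : Finset β := Finset.univ.filter fun b => ∀ a, P b a
  have hT : T.card * Fintype.card α ≤ ℓ ^ 2 := by
    rw [← Finset.card_univ, ← Finset.card_product]
    refine (Finset.card_le_card fun p hp => ?_).trans hcard
    simp only [T, Finset.mem_product, Finset.mem_filter, Finset.mem_univ, true_and,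
      and_true] at hp
    exact hS p.1 p.2 (hp p.2)
  -- Each full line uses at least `3 * ℓ` of at most `ℓ ^ 2` vertices, so at most `ℓ / 3` lines are
  -- full; all the others meet the given transversal line and are mixed.
  have hle : 3 * T.card ≤ ℓ := by
    have : T.card * (3 * ℓ) ≤ ℓ ^ 2 := (Nat.mul_le_mul_left _ hα).trans hT
    by_contra! hlt
    nlinarith
  have hsum : mixedCount P + T.card = Fintype.card β := by
    have hTeq : T = Finset.univ.filter fun b => ¬ ((∃ a, P b a) ∧ ∃ a, ¬ P b a) := by
      refine Finset.filter_congr fun b _ => ⟨?_, ?_⟩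
      · rintro h1 ⟨-, a, h2⟩; exact h2 (h1 a)
      · intro h1 a
        by_contra h2
        exact h1 ⟨⟨a₀, ha₀ b⟩, a, h2⟩
    have := Finset.card_filter_add_card_filter_not (s := (Finset.univ : Finset β))
      (fun b => (∃ a, P b a) ∧ ∃ a, ¬ P b a)
    rw [hTeq, ← Finset.card_univ, ← this, mixedCount]
    congr!
  omega

/-- Without full lines, the set lies in the product of its mixed rows and mixed columns; a full line
in either direction already forces many mixed lines. -/
theorem mixedCount_dichotomy {α β : Type*} [Fintype α] [Fintype β] {P : α → β → Prop} {ℓ : ℕ}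
    (hα : 3 * ℓ ≤ Fintype.card α) (hβ : 3 * ℓ ≤ Fintype.card β) {S : Finset (α × β)}
    (hS : ∀ p, p ∈ S ↔ P p.1 p.2) (hcard : S.card ≤ ℓ ^ 2) :
    2 * ℓ ≤ mixedCount P + mixedCount (fun b a => P a b) ∨
      S.card ≤ mixedCount P * mixedCount (fun b a => P a b) := by
  classical
  by_cases hrow : ∃ b, ∀ a, P a b
  · obtain ⟨b, hb⟩ := hrow
    have := two_mul_le_mixedCount (P := P) hβ hα (fun a b hab => (hS (a, b)).2 hab) hcard hb
    omega
  by_cases hcol : ∃ a, ∀ b, P a b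
  · obtain ⟨a, ha⟩ := hcol
    have := two_mul_le_mixedCount (P := fun b a => P a b) hα hβ
      (S := S.map (Equiv.prodComm α β).toEmbedding)
      (fun b a hab => by simpa [hS] using hab) (by simpa using hcard) ha
    omega
  right
  push Not at hrow hcol
  rw [mixedCount, mixedCount, ← Finset.card_product]
  refine Finset.card_le_card fun p hp => ?_
  have hp' := (hS p).1 hp
  simp only [Finset.mem_product, Finset.mem_filter, Finset.mem_univ, true_and]
  exact ⟨⟨⟨p.2, hp'⟩, hcol p.1⟩, ⟨p.1, hp'⟩, hrow p.2⟩

/-- The number of vertices of spin different from `1`. -/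
def area {K L q : ℕ} (σ : Config K L q) : ℕ :=
  (Finset.univ.filter fun v => (σ v : ℕ) ≠ 1).card

theorem area_dichotomy {K L q ℓ : ℕ} (hK : 3 * ℓ ≤ K) (hL : 3 * ℓ ≤ L) {σ : Config K L q}
    (hσ : area σ ≤ ℓ ^ 2) :
    2 * ℓ ≤ mixedCount (fun x y => (σ (x, y) : ℕ) ≠ 1)
        + mixedCount (fun y x => (σ (x, y) : ℕ) ≠ 1) ∨
      area σ ≤ mixedCount (fun x y => (σ (x, y) : ℕ) ≠ 1)
        * mixedCount (fun y x => (σ (x, y) : ℕ) ≠ 1) :=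
  mixedCount_dichotomy (by simpa using hK) (by simpa using hL) (fun p => by simp) hσ

section Isoperimetry

variable {K L q : ℕ} [NeZero K] [NeZero L] {h : ℝ}

theorem energy_sub_energy_allOne (hK : 3 ≤ K) (hL : 3 ≤ L) (hq : 2 < q) (σ : Config K L q) :
    energy K L q h σ - energy K L q h (allOne K L q hq)
      = ∑ v, (dis (σ v) (σ (v + unitX K L)) + dis (σ v) (σ (v + unitY K L))) - h * area σ := by
  have harea : (area σ : ℝ) = ∑ v, (1 - one (σ v)) := by
    rw [area, Finset.card_eq_sum_ones, Nat.cast_sum, Finset.sum_filter]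
    refine Finset.sum_congr rfl fun v _ => ?_
    by_cases hv : (σ v : ℕ) = 1
    · simp [hv, one_of_eq]
    · simp [hv, one_of_ne]
  have hall : ∀ v, one (allOne K L q hq v) = 1 := fun v => one_of_eq rfl
  have hall' : ∀ v w, agr (allOne K L q hq v) (allOne K L q hq w) = 1 := fun v w => agr_self _
  rw [energy_eq hK hL, energy_eq hK hL, harea]
  simp only [hall, hall', agr_eq, Finset.sum_sub_distrib, Finset.sum_add_distrib]
  ring

/-- Each mixed row or column contributes at least two broken bonds; disagreements among spins
different from `1` only add energy. -/
theorem two_mul_mixedCount_le_energy (hK : 3 ≤ K) (hL : 3 ≤ L) (hq : 2 < q)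
    (σ : Config K L q) :
    2 * ((mixedCount (fun x y => (σ (x, y) : ℕ) ≠ 1) : ℝ)
        + mixedCount (fun y x => (σ (x, y) : ℕ) ≠ 1)) - h * area σ
      ≤ energy K L q h σ - energy K L q h (allOne K L q hq) := by
  rw [energy_sub_energy_allOne hK hL hq, Finset.sum_add_distrib]
  have h1 := two_mul_mixedCount_le (fun x y => σ (x, y))
  have h2 := two_mul_mixedCount_le (fun y x => σ (x, y))
  have h3 : ∑ v, dis (σ v) (σ (v + unitX K L)) = ∑ y, ∑ x, dis (σ (x, y)) (σ (x + 1, y)) := by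
    rw [Fintype.sum_prod_type_right]
    simp
  have h4 : ∑ v, dis (σ v) (σ (v + unitY K L)) = ∑ x, ∑ y, dis (σ (x, y)) (σ (x, y + 1)) := by
    rw [Fintype.sum_prod_type]
    simp
  linarith

/-- Below the critical area the energy is at least that of `allOne`. -/
theorem energy_allOne_le {ℓ : ℕ} (hℓ : 3 ≤ ℓ) (h0 : 0 < h) (h1 : h < 1) (hlo : (ℓ - 1) * h < 2)
    (hK : 3 * ℓ ≤ K) (hL : 3 * ℓ ≤ L) (hq : 2 < q) {σ : Config K L q}
    (hσ : area σ ≤ ℓ * (ℓ - 1)) :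
    energy K L q h (allOne K L q hq) ≤ energy K L q h σ := by
  have hE := two_mul_mixedCount_le_energy (h := h) (by omega) (by omega) hq σ
  have hd := area_dichotomy hK hL (σ := σ)
    (hσ.trans (by rw [pow_two]; exact Nat.mul_le_mul_left _ (Nat.sub_le _ _)))
  generalize mixedCount (fun x y => (σ (x, y) : ℕ) ≠ 1) = A at hE hd
  generalize mixedCount (fun y x => (σ (x, y) : ℕ) ≠ 1) = B at hE hd
  generalize area σ = n at hE hd hσ
  have hσ' : (n : ℝ) ≤ ℓ * (ℓ - 1) := by
    have : ((ℓ - 1 : ℕ) : ℝ) = ℓ - 1 := by rw [Nat.cast_sub (by omega)]; simp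
    rw [← this]; exact_mod_cast hσ
  have hℓ' : (3 : ℝ) ≤ ℓ := by exact_mod_cast hℓ
  have hA : (0 : ℝ) ≤ A := Nat.cast_nonneg A
  have hB : (0 : ℝ) ≤ B := Nat.cast_nonneg B
  suffices h * n ≤ 2 * ((A : ℝ) + B) by linarith
  rcases le_or_gt (2 * (ℓ : ℝ)) (A + B) with hge | hlt
  · have e1 : h * n ≤ h * (ℓ * (ℓ - 1)) := mul_le_mul_of_nonneg_left hσ' h0.le
    nlinarith
  · have hd' : (n : ℝ) ≤ A * B := by
      rcases hd with hd | hd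
      · have : (2 : ℝ) * ℓ ≤ A + B := by exact_mod_cast hd
        linarith
      · exact_mod_cast hd
    have e1 : 4 * (n : ℝ) ≤ (A + B) ^ 2 := by nlinarith [sq_nonneg ((A : ℝ) - B)]
    have e2 : ((A : ℝ) + B) ^ 2 ≤ (A + B) * (2 * ℓ) := by
      rw [pow_two]; exact mul_le_mul_of_nonneg_left hlt.le (by linarith)
    have e3 : h * (4 * n) ≤ h * ((A + B) * (2 * ℓ)) :=
      mul_le_mul_of_nonneg_left (e1.trans e2) h0.le
    -- From `(ℓ - 1) * h < 2` and `h < 1` follows `ℓ * h < 3`.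
    have e4 : (A + B : ℝ) * (ℓ * h) ≤ (A + B) * 3 :=
      mul_le_mul_of_nonneg_left (by linarith) (by linarith)
    nlinarith

/-- The energy at the critical area. -/
theorem energy_critical_le {ℓ : ℕ} (hℓ : 3 ≤ ℓ)
    (hK : 3 * ℓ ≤ K) (hL : 3 * ℓ ≤ L) (hq : 2 < q) {σ : Config K L q}
    (hσ : area σ = ℓ * (ℓ - 1) + 1) :
    energy K L q h (allOne K L q hq) + (4 * (ℓ : ℝ) - h * ((ℓ : ℝ) * ((ℓ : ℝ) - 1) + 1))
      ≤ energy K L q h σ := by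
  have hE := two_mul_mixedCount_le_energy (h := h) (by omega) (by omega) hq σ
  obtain ⟨k, rfl⟩ : ∃ k, ℓ = k + 1 := ⟨ℓ - 1, by omega⟩
  rw [Nat.add_sub_cancel] at hσ
  have hd := area_dichotomy hK hL (σ := σ) (by rw [hσ]; nlinarith)
  generalize mixedCount (fun x y => (σ (x, y) : ℕ) ≠ 1) = A at hE hd
  generalize mixedCount (fun y x => (σ (x, y) : ℕ) ≠ 1) = B at hE hd
  rw [hσ] at hE hd
  -- If `A + B ≤ 2k + 1`, then `A * B ≤ k (k + 1)`, one vertex too few: the critical area is the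
  -- least one that does not fit.
  have hAB : 2 * (k + 1) ≤ A + B := by
    rcases hd with hd | hd
    · exact hd
    · by_contra! hlt
      have h1 : A + B ≤ 2 * k + 1 := by omega
      have h2 : 4 * (A * B) ≤ (A + B) ^ 2 := by
        zify; nlinarith [sq_nonneg ((A : ℤ) - B)]
      have h3 : (A + B) ^ 2 ≤ (2 * k + 1) ^ 2 := Nat.pow_le_pow_left h1 2
      nlinarith
  have hAB' : 2 * ((k : ℝ) + 1) ≤ A + B := by exact_mod_cast hAB
  push_cast at hE ⊢
  have e : h * (((k : ℝ) + 1) * (k + 1 - 1) + 1) = h * ((k + 1) * k + 1) := by ring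
  rw [e]
  linarith

end Isoperimetry

theorem area_le_of_connectivity {K L q : ℕ} {σ τ : Config K L q}
    (hστ : 0 < connectivity K L q σ τ) : area τ ≤ area σ + 1 := by
  have hcard : (Finset.univ.filter fun v => σ v ≠ τ v).card = 1 := by
    by_contra hne
    rw [connectivity, if_neg hne] at hστ
    exact lt_irrefl _ hστ
  rw [← hcard]
  refine (Finset.card_le_card fun v hv => ?_).trans (Finset.card_union_le _ _)
  simp only [Finset.mem_union, Finset.mem_filter, Finset.mem_univ, true_and] at hv ⊢
  by_cases heq : σ v = τ v
  · left; rwa [heq]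
  · right; exact heq

/-- A path from a smaller to a larger area takes every area in between. -/
theorem exists_area_eq {K L q : ℕ} {σ η : Config K L q} {n : ℕ} (hσ : area σ < n)
    (hη : n ≤ area η) (ω : Landscape.Path (connectivity K L q) σ η) :
    ∃ i, area (ω.state i) = n := by
  by_contra! hne
  have hlt : ∀ i, area (ω.state i) < n := by
    intro i
    induction i using Fin.induction with
    | zero => rwa [ω.source]
    | succ i ih =>
      exact lt_of_le_of_ne ((area_le_of_connectivity (ω.step i)).trans ih) (hne _)
  have := hlt (Fin.last _)
  rw [ω.target] at this
  omega

end Potts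

namespace Potts

/-! ### The critical length -/

theorem lt_criticalLength_mul {h : ℝ} (hpos : 0 < h) (hint : ∀ n : ℤ, 2 / h ≠ (n : ℝ)) :
    2 < criticalLength h * h := by
  have h1 : 2 / h < criticalLength h :=
    lt_of_le_of_ne (Nat.le_ceil _) (by simpa using hint (criticalLength h))
  rwa [div_lt_iff₀ hpos] at h1

theorem criticalLength_sub_one_mul_lt {h : ℝ} (hpos : 0 < h) : (criticalLength h - 1) * h < 2 := by
  have h1 : (criticalLength h : ℝ) < 2 / h + 1 := Nat.ceil_lt_add_one (by positivity)
  rw [← lt_div_iff₀ hpos]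
  linarith

theorem three_le_criticalLength {h : ℝ} (hlt : h < 1) (h2 : 2 < criticalLength h * h) :
    3 ≤ criticalLength h := by
  have : (2 : ℝ) < criticalLength h := by
    nlinarith [Nat.cast_nonneg (α := ℝ) (criticalLength h)]
  exact_mod_cast this

/-- The energy of the quasi-square with a protuberance is maximal at the critical length. -/
theorem quasiSquare_le {h : ℝ} {ℓ : ℕ} (hlo : (ℓ - 1) * h < 2) (hhi : 2 < ℓ * h)
    (b : ℕ) :
    4 * (b : ℝ) + 4 - h * (b ^ 2 + b + 1) ≤ 4 * ℓ - h * (ℓ * (ℓ - 1) + 1) := by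
  -- The height is quadratic in `b` and equals the critical value at `b = ℓ - 1`. Below that both
  -- factors are nonpositive, above it both are nonnegative.
  have key : 4 * (b : ℝ) + 4 - h * (b ^ 2 + b + 1)
      = 4 * ℓ - h * (ℓ * (ℓ - 1) + 1) - ((b : ℝ) - (ℓ - 1)) * (h * (b + ℓ) - 4) := by ring
  rw [key]
  rcases Nat.lt_or_ge b ℓ with hb | hb
  · have hb' : (b : ℝ) + 1 ≤ ℓ := by exact_mod_cast hb
    rcases Nat.lt_or_ge (b + 1) ℓ with hb2 | hb2
    · have hb2' : (b : ℝ) + 1 + 1 ≤ ℓ := by exact_mod_cast hb2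
      have : 0 ≤ (ℓ - 1 - (b : ℝ)) * (4 - h * (b + ℓ)) :=
        mul_nonneg (by linarith) (by nlinarith)
      linarith
    · have : (ℓ : ℝ) = b + 1 := by exact_mod_cast (by omega : ℓ = b + 1)
      rw [this]; simp
  · have hb' : (ℓ : ℝ) ≤ b := by exact_mod_cast hb
    have : 0 ≤ ((b : ℝ) - (ℓ - 1)) * (h * (b + ℓ) - 4) :=
      mul_nonneg (by linarith) (by nlinarith)
    linarith

/-- The energy of the square with a protuberance is at most the critical energy. -/
theorem square_le {h : ℝ} {ℓ : ℕ} (hlo : (ℓ - 1) * h < 2) (hhi : 2 < ℓ * h)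
    (b : ℕ) :
    4 * (b : ℝ) + 2 - h * (b ^ 2 + 1) ≤ 4 * ℓ - h * (ℓ * (ℓ - 1) + 1) := by
  rcases Nat.lt_or_ge b ℓ with hb | hb
  · have hb' : (b : ℝ) + 1 ≤ ℓ := by exact_mod_cast hb
    have h1 := quasiSquare_le hlo hhi b
    -- The square and quasi-square heights at `b` differ by `2 - h * b`, nonnegative for `b ≤ ℓ -
    -- 1`; for `b ≥ ℓ` the comparison is with the preceding quasi-square.
    nlinarith
  · have hb' : (ℓ : ℝ) ≤ b := by exact_mod_cast hb
    obtain ⟨c, rfl⟩ : ∃ c, b = c + 1 := by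
      refine ⟨b - 1, (Nat.sub_add_cancel (Nat.pos_of_ne_zero ?_)).symm⟩
      rintro rfl
      obtain rfl : ℓ = 0 := by omega
      norm_num at hhi
    have h1 := quasiSquare_le hlo hhi c
    push_cast at hb' ⊢
    nlinarith

section Main

variable {K L q : ℕ} [NeZero K] [NeZero L] {h : ℝ} {ℓ : ℕ}

theorem critical_le_commHeightSet (hℓ : 3 ≤ ℓ) (hpos : 0 < h) (hlt : h < 1)
    (hlo : (ℓ - 1) * h < 2) (hK : 3 * ℓ ≤ K) (hL : 3 * ℓ ≤ L) (hq : 2 < q) :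
    ((energy K L q h (allOne K L q hq) + (4 * (ℓ : ℝ) - h * ((ℓ : ℝ) * ((ℓ : ℝ) - 1) + 1)) : ℝ)
        : EReal)
      ≤ Landscape.commHeightSet (energy K L q h) (connectivity K L q) {allOne K L q hq}
        (Landscape.lowerStates (energy K L q h) (allOne K L q hq)) := by
  refine Landscape.le_commHeightSet fun η hη ω => ?_
  have h1 : area (allOne K L q hq) = 0 := by
    rw [area, Finset.card_eq_zero, Finset.filter_eq_empty_iff]
    intro v _
    simp [allOne]
  have h2 : ℓ * (ℓ - 1) + 1 ≤ area η := by
    by_contra! hlt'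
    exact absurd hη (not_lt.2 (energy_allOne_le hℓ hpos hlt hlo hK hL hq (by omega)))
  obtain ⟨i, hi⟩ := exists_area_eq (by omega) h2 ω
  exact ⟨i, energy_critical_le hℓ hK hL hq hi⟩

theorem commHeightSet_le_critical (hℓ : 3 ≤ ℓ) (hpos : 0 < h)
    (hlo : (ℓ - 1) * h < 2) (hhi : 2 < ℓ * h) (hK : 3 * ℓ ≤ K) (hL : 3 * ℓ ≤ L) (hq : 2 < q)
    (hΓ : 2 < 4 * (ℓ : ℝ) - h * ((ℓ : ℝ) * ((ℓ : ℝ) - 1) + 1)) :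
    Landscape.commHeightSet (energy K L q h) (connectivity K L q) {allOne K L q hq}
        (Landscape.stableStates (energy K L q h))
      ≤ ((energy K L q h (allOne K L q hq)
        + (4 * (ℓ : ℝ) - h * ((ℓ : ℝ) * ((ℓ : ℝ) - 1) + 1)) : ℝ) : EReal) := by
  set Γ := 4 * (ℓ : ℝ) - h * ((ℓ : ℝ) * ((ℓ : ℝ) - 1) + 1) with hΓdef
  let a : Spin q := ⟨1, Finset.mem_Icc.mpr ⟨le_refl 1, by omega⟩⟩
  let s : Spin q := ⟨2, Finset.mem_Icc.mpr ⟨by omega, by omega⟩⟩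
  have hall : allOne K L q hq = fun _ => a := rfl
  -- Side `2 * ℓ` fits into the torus, and its excess energy is at most `8ℓ - 4hℓ²`, negative
  -- because `ℓ * h > 2`.
  obtain ⟨hr, hE⟩ := reach_droplet_square (K := K) (L := L) (a := a) (s := s) (h := h)
    (C := energy K L q h (allOne K L q hq) + Γ) (N := 2 * ℓ) (b := 2 * ℓ - 1)
    (by omega) (by omega) hpos.le perp_unitX_unitY rfl (by simp [s])
    (by rw [addOrderOf_unitX]; omega) (by rw [addOrderOf_unitY]; omega)
    (fun b => by rw [hall, add_sub_cancel_left]; exact square_le hlo hhi b)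
    (fun b => by rw [hall, add_sub_cancel_left]; exact quasiSquare_le hlo hhi b)
    (by omega)
  rw [← hall] at hr hE
  have hb : (((2 * ℓ - 1 : ℕ) : ℝ) + 1) = 2 * ℓ := by
    rw [Nat.cast_sub (by omega)]; push_cast; ring
  rw [hb] at hE
  have hℓ0 : (0 : ℝ) < ℓ := by exact_mod_cast (by omega : 0 < ℓ)
  obtain ⟨η, hη, hrη⟩ := exists_reach_stable (by omega) (by omega) hpos.le hq
    (lt_of_le_of_lt hE (by nlinarith))
  obtain ⟨ω, hω⟩ := Reach.exists_path (by omega) (hr.trans (hrη.mono (by linarith)))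
    (by linarith)
  exact Landscape.commHeightSet_le hη ω hω

theorem allOne_notMem_stableStates (hK : 3 ≤ K) (hL : 3 ≤ L) (hpos : 0 < h) (hq : 2 < q) :
    allOne K L q hq ∉ Landscape.stableStates (energy K L q h) := by
  intro hst
  let s : Spin q := ⟨2, Finset.mem_Icc.mpr ⟨by omega, by omega⟩⟩
  have h1 := hst.2 (fun _ => s) (Set.mem_univ _)
  have h2 := energy_sub_energy_allOne (h := h) hK hL hq (fun _ => s)
  have h3 : area (fun _ : Fin K × Fin L => s) = Fintype.card (Fin K × Fin L) := by
    simp [area, s]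
  have h4 : (0 : ℝ) < Fintype.card (Fin K × Fin L) := Nat.cast_pos.2 Fintype.card_pos
  rw [h3] at h2
  simp only [dis_self, add_zero, Finset.sum_const_zero] at h2
  nlinarith

end Main

end Potts

/-! ### Identification of the metastable state -/

theorem theorem4p4 (q K L : ℕ) (h : ℝ) (hq : 2 < q) (hpos : 0 < h) (hlt : h < 1)
    (hint : ∀ n : ℤ, 2 / h ≠ (n : ℝ))
    (hK : 3 * Potts.criticalLength h ≤ K) (hKL : K ≤ L) :
    Landscape.metastableStates (Potts.energy K L q h) (Potts.connectivity K L q)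
        = {Potts.allOne K L q hq} ∧
    Landscape.stabilityLevel (Potts.energy K L q h) (Potts.connectivity K L q)
        (Potts.allOne K L q hq)
      = Landscape.barrier (Potts.energy K L q h) (Potts.connectivity K L q)
          (Potts.allOne K L q hq) (Landscape.stableStates (Potts.energy K L q h)) ∧
    Landscape.barrier (Potts.energy K L q h) (Potts.connectivity K L q)
        (Potts.allOne K L q hq) (Landscape.stableStates (Potts.energy K L q h))
      = ((4 * (Potts.criticalLength h : ℝ)
          - h * ((Potts.criticalLength h : ℝ) * ((Potts.criticalLength h : ℝ) - 1) + 1) : ℝ)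
          : EReal) := by
  have hhi := Potts.lt_criticalLength_mul hpos hint
  have hlo := Potts.criticalLength_sub_one_mul_lt hpos
  have hℓ := Potts.three_le_criticalLength hlt hhi
  generalize Potts.criticalLength h = ℓ at *
  have hL : 3 * ℓ ≤ L := hK.trans hKL
  have : NeZero K := ⟨by omega⟩
  have : NeZero L := ⟨by omega⟩
  have hK3 : 3 ≤ K := by omega
  have hL3 : 3 ≤ L := by omega
  have hℓ' : (3 : ℝ) ≤ ℓ := by exact_mod_cast hℓ
  have hΓ : 2 < 4 * (ℓ : ℝ) - h * ((ℓ : ℝ) * ((ℓ : ℝ) - 1) + 1) := by nlinarith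
  have hnot := Potts.allOne_notMem_stableStates (h := h) hK3 hL3 hpos hq
  have hsub : Landscape.stableStates (Potts.energy K L q h)
      ⊆ Landscape.lowerStates (Potts.energy K L q h) (Potts.allOne K L q hq) := by
    intro η hη
    by_contra hge
    exact hnot ⟨Set.mem_univ _, fun τ hτ => (not_lt.1 hge).trans (hη.2 τ hτ)⟩
  have hlow := Potts.critical_le_commHeightSet (h := h) hℓ hpos hlt hlo hK hL hq
  have hup := Potts.commHeightSet_le_critical (h := h) hℓ hpos hlo hhi hK hL hq hΓ
  have hanti := Landscape.commHeightSet_anti (H := Potts.energy K L q h)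
    (Q := Potts.connectivity K L q) (A := {Potts.allOne K L q hq}) hsub
  -- The lower bound concerns the larger target, all lower states, and the upper bound the smaller
  -- one, the stable states; monotonicity in the target makes both heights equal.
  have hstab := Landscape.barrier_eq (le_antisymm (hanti.trans hup) hlow)
  have hbar := Landscape.barrier_eq (le_antisymm hup (hlow.trans hanti))
  rw [← Landscape.stabilityLevel] at hstab
  generalize 4 * (ℓ : ℝ) - h * ((ℓ : ℝ) * ((ℓ : ℝ) - 1) + 1) = Γ at *
  refine ⟨?_, hstab.trans hbar.symm, hbar⟩
  have hother : ∀ σ ∉ Landscape.stableStates (Potts.energy K L q h), σ ≠ Potts.allOne K L q hq →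
      Landscape.stabilityLevel (Potts.energy K L q h) (Potts.connectivity K L q) σ
        < (Γ : EReal) := by
    intro σ hσ hne
    obtain ⟨v, hv⟩ : ∃ v, (σ v : ℕ) ≠ 1 := by
      by_contra! hall
      exact hne (funext fun v => Subtype.ext (hall v))
    exact (Potts.stabilityLevel_le_two hK3 hL3 hpos.le (by omega) hσ hv).trans_lt
      (EReal.coe_lt_coe_iff.2 hΓ)
  have hsup : ⨆ σ ∈ (Landscape.stableStates (Potts.energy K L q h))ᶜ,
      Landscape.stabilityLevel (Potts.energy K L q h) (Potts.connectivity K L q) σ = (Γ : EReal) := by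
    refine le_antisymm (iSup₂_le fun σ hσ => ?_) ?_
    · by_cases hne : σ = Potts.allOne K L q hq
      · rw [hne, hstab]
      · exact (hother σ hσ hne).le
    · rw [← hstab]
      exact le_iSup₂ (f := fun σ (_ : σ ∈ (Landscape.stableStates (Potts.energy K L q h))ᶜ) =>
        Landscape.stabilityLevel (Potts.energy K L q h) (Potts.connectivity K L q) σ) _ hnot
  ext σ
  rw [Landscape.metastableStates, Set.mem_ofPred_eq, hsup, Set.mem_singleton_iff]
  refine ⟨fun hσ => ?_, fun hσ => by rw [hσ, hstab]⟩
  by_contra hne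
  by_cases hst : σ ∈ Landscape.stableStates (Potts.energy K L q h)
  -- The defining equation does not itself exclude stable states; they drop out because their level
  -- is `⊤` while the supremum is finite.
  · rw [Landscape.stabilityLevel_eq_top hst] at hσ
    exact EReal.coe_ne_top Γ hσ.symm
  · exact (hother σ hst hne).ne hσ
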